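/- Let $\Omega\subset\mathbb{C}^n$ be a bounded pseudo-convex domain with $\mathcal{C}^\infty$ boundary, and let $\rho$ be a smooth defining function of $\Omega$ (that is, $\rho$ is real and $\mathcal{C}^\infty$ on an open neighbourhood $U$ of $\overline\Omega$, $\Omega=\{z\in U:\rho(z)<0\}$ and $\nabla\rho\ne0$ on $\partial\Omega$) such that, for some $s\in\,]0,1]$, $-(-\rho)^s$ is strictly plurisubharmonic in $\Omega$ (a Diederich–Fornæss defining function). Let $h:\mathbb{C}^m\to\mathbb{R}$ satisfy Condition III, that is, $h(w)=\sum_{i=1}^m h_i(w_i)$ for $w=(w_1,\dots,w_m)$, $w_i\in\mathbb{C}$, where each $h_i:\mathbb{C}\to\mathbb{R}$ is $\mathcal{C}^\infty$, non-negative and subharmonic and satisfies: 1. $h_i(w)=0\iff w=0$; $\nabla h_i(w)\neq0$ if $w\ne0$; $h_i(w)\to+\infty$ as $|w|\to+\infty$; 2. $\log h_i$ is subharmonic, i.e. $\frac{\partial^2h_i}{\partial w\,\partial\overline w}\ge\frac1{h_i}\left|\frac{\partial h_i}{\partial w}\right|^2$ for $w\neq 0$, and $h_i$ is strictly subharmonic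 outside the origin, i.e. $\frac{\partial^2h_i}{\partial w\,\partial\overline w}>0$ there; 3. $h_i$ is of finite type at the origin, i.e. $\sup_\varphi \frac{\mathrm{ord}_0(h_i\circ\varphi)}{\mathrm{ord}_0(\varphi)}<+\infty$, the supremum being over all non-zero holomorphic functions $\varphi$ from the unit disc to $\mathbb{C}$ with $\varphi(0)=0$, where $\mathrm{ord}_0$ is the least order of a non-vanishing derivative at $0$; 4. there is a $\mathcal{C}^\infty$ function $\alpha_i$ on a neighbourhood of $0$ in $\mathbb{C}$ such that $\lim_{w\to0}\alpha_i(w)=0$ and $\frac{\partial h_i}{\partial w}=\alpha_i\,\frac{\partial^2h_i}{\partial w\,\partial\overline w}$ in that neighbourhood. Put $r(z,w)=\rho(z)+h(w)$ and $\widetilde\Omega=\{(z,w)\in U\times\mathbb{C}^m: r(z,w)<0\}$. Assume that at every point $z\in\partial\Omega$ the Levi form of $\rho$, that is, the restriction of $\partial\overline\partial\rho(z)$ to the complex tangent space $\{t\in\mathbb{C}^n:\sum_i\frac{\partial\rho}{\partial z_i}(z)\,t_i=0\}$, has rank $\ge n-2$. Then $\widetilde\Omega$ has a locally diagonalizable Levi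 form at every point of its boundary: every $p\in\partial\widetilde\Omega$ has an open neighbourhood $V$ on which $r$ is $\mathcal{C}^\infty$ with $\nabla r\neq0$ and on which there are $n+m-1$ vector fields $L_1,\dots,L_{n+m-1}$ of type $(1,0)$ with $\mathcal{C}^\infty$ coefficients such that, at each point of $V$, $L_1,\dots,L_{n+m-1}$ form a basis of the space of $(1,0)$ vectors $L$ with $\langle\partial r,L\rangle=0$, and $\left\langle\partial\overline\partial r;L_i,\overline{L_j}\right\rangle=0$ whenever $i\ne j$. -/

import Mathlib

open Set Filter Topology
open scoped ContDiff ENNReal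

noncomputable section

namespace Hartogs

section Calculus

variable {E : Type*} [NormedAddCommGroup E] [NormedSpace ℂ E]

/-- The `(1,0)` derivative `∂g(z)`, as a complex linear form on the space: in coordinates
`∂g(z)(t) = ∑ i, t i * ∂g/∂z_i (z)`. A vector `t` stands for the `(1,0)` tangent vector
`∑ i, t i * ∂/∂z_i`. -/
def del (g : E → ℂ) (z : E) : E →ₗ[ℂ] ℂ where
  toFun t := (fderiv ℝ g z t - Complex.I * fderiv ℝ g z (Complex.I • t)) / 2
  map_add' s t := by
    simp only [smul_add, map_add]
    ring
  map_smul' c t := by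
    have h1 : c • t = c.re • t + c.im • (Complex.I • t) := by
      conv_lhs => rw [← Complex.re_add_im c]
      rw [add_smul, mul_smul]
      rfl
    have h2 : Complex.I • (c • t) = c.re • (Complex.I • t) - c.im • t := by
      rw [h1, smul_add, smul_comm Complex.I c.re, smul_comm Complex.I c.im, smul_smul Complex.I,
        Complex.I_mul_I, neg_one_smul, smul_neg, sub_eq_add_neg]
    have hI := Complex.I_mul_I
    rw [h2, h1]
    simp only [map_add, map_sub, map_smul, RingHom.id_apply, smul_eq_mul, Complex.real_smul]
    conv_rhs => rw [← Complex.re_add_im c]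
    linear_combination (c.im : ℂ) * fderiv ℝ g z (Complex.I • t) / 2 * hI

/-- The `(0,1)` derivative: in coordinates
`delBar g z t = ∑ j, conj (t j) * ∂g/∂(conj z_j) (z)`. -/
def delBar (g : E → ℂ) (z t : E) : ℂ :=
  (fderiv ℝ g z t + Complex.I * fderiv ℝ g z (Complex.I • t)) / 2

/-- The form `⟨∂∂̄f(z); s, t̄⟩ = ∑ i j, ∂²f/∂z_i∂(conj z_j) (z) * s i * conj (t j)` of a
real function `f`. -/
def complexHessian (f : E → ℝ) (z s t : E) : ℂ :=
  del (fun y => delBar (fun x => (f x : ℂ)) y t) z s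

/-- The complex tangent space at `z` of the level set of `f` through `z`: the vectors `t` with
`∑ i, ∂f/∂z_i (z) * t i = 0`. -/
def complexTangent (f : E → ℝ) (z : E) : Submodule ℂ E :=
  LinearMap.ker (del (fun x => (f x : ℂ)) z)

/-- The Levi form of `f` at `z`, i.e. the restriction of `∂∂̄f(z)` to the complex tangent space
`T`, as the map which sends `s` in `T` to the function `t ↦ ⟨∂∂̄f(z); s, t̄⟩` on `T`. -/
def leviMap (f : E → ℝ) (z : E) :
    complexTangent f z →ₗ[ℂ] (complexTangent f z → ℂ) :=
  LinearMap.pi fun t =>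
    (del (fun y => delBar (fun x => (f x : ℂ)) y (t : E)) z).comp (complexTangent f z).subtype

/-- The rank of the Levi form of `f` at `z`. -/
def leviRank (f : E → ℝ) (z : E) : ℕ :=
  Module.finrank ℂ (LinearMap.range (leviMap f z))

/-- `f` is strictly plurisubharmonic on `D` (for `f` twice continuously differentiable near each
point of the open set `D`): its complex Hessian is positive definite. -/
def StrictlyPlurisubharmonicOn (f : E → ℝ) (D : Set E) : Prop :=
  ∀ z ∈ D, ∀ t : E, t ≠ 0 → 0 < (complexHessian f z t t).re

/-- `r`, smooth on the open neighbourhood `U` of the closure of `D`, is a smooth defining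
function of `D`. -/
structure IsDefiningFunction (D U : Set E) (r : E → ℝ) : Prop where
  isOpen : IsOpen U
  closure_subset : closure D ⊆ U
  smooth : ContDiffOn ℝ ∞ r U
  eq_neg : D = {z | z ∈ U ∧ r z < 0}
  grad_ne : ∀ z ∈ frontier D, fderiv ℝ r z ≠ 0

/-- `D` is a bounded pseudoconvex domain with smooth boundary, with smooth defining function `r`
on `U`. (Levi) pseudoconvexity does not depend on the choice of the defining function. -/
structure IsSmoothBoundedPseudoconvex (D U : Set E) (r : E → ℝ) : Prop where
  connected : IsConnected D
  bounded : Bornology.IsBounded D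
  defining : IsDefiningFunction D U r
  levi_nonneg : ∀ z ∈ frontier D, ∀ t ∈ complexTangent r z, 0 ≤ (complexHessian r z t t).re

/-- `r` is a Diederich–Fornæss defining function with exponent `s`: `-(-r)^s` is strictly
plurisubharmonic in `D`. -/
def IsDiederichFornaess (D : Set E) (r : E → ℝ) (s : ℝ) : Prop :=
  0 < s ∧ s ≤ 1 ∧ StrictlyPlurisubharmonicOn (fun z => -(-r z) ^ s) D

/-- `D` has a smooth boundary near `p` with local defining function `r`, and its Levi form is
locally diagonalizable at `p`: on an open neighbourhood `V` of `p` there are smooth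
`(1,0)` vector fields `L_1, …, L_{d-1}`, with `d` the dimension of the space, which form at each
point of `V` a basis of the complex tangent space of the level set of `r`, and in which the matrix
of the Levi form of `r` is diagonal at each point of `V`. -/
def HasLocallyDiagonalizableLeviFormAt (D : Set E) (r : E → ℝ) (p : E) : Prop :=
  ∃ V : Set E, IsOpen V ∧ p ∈ V ∧ ContDiffOn ℝ ∞ r V ∧ D ∩ V = {q | q ∈ V ∧ r q < 0} ∧
    (∀ q ∈ V, fderiv ℝ r q ≠ 0) ∧
    ∃ L : Fin (Module.finrank ℂ E - 1) → E → E,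
      (∀ j, ContDiffOn ℝ ∞ (L j) V) ∧
      (∀ q ∈ V, LinearIndependent ℂ (fun j => L j q) ∧
        Submodule.span ℂ (Set.range fun j => L j q) = complexTangent r q) ∧
      ∀ q ∈ V, ∀ i j, i ≠ j → complexHessian r q (L i q) (L j q) = 0

end Calculus

section FiniteType

/-- The order of `g` at the origin: the least order of a nonzero derivative of `g` at `0`,
and `⊤` if there is none. -/
def orderAtZero {E F : Type*} [NormedAddCommGroup E] [NormedSpace ℝ E]
    [NormedAddCommGroup F] [NormedSpace ℝ F] (g : E → F) : ℕ∞ :=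
  ⨅ k ∈ {k : ℕ | iteratedFDeriv ℝ k g 0 ≠ 0}, (k : ℕ∞)

/-- The type of `f` at the origin: the supremum of `ord (f ∘ φ) / ord φ` over all nonzero
holomorphic maps `φ` from the unit disc with `φ 0 = 0`. -/
def typeAtZero {E : Type*} [NormedAddCommGroup E] [NormedSpace ℂ E] (f : E → ℝ) : ℝ≥0∞ :=
  ⨆ φ ∈ {φ : ℂ → E | DifferentiableOn ℂ φ (Metric.ball 0 1) ∧ φ 0 = 0 ∧
      ∃ ζ ∈ Metric.ball (0 : ℂ) 1, φ ζ ≠ 0},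
    (orderAtZero (f ∘ φ) : ℝ≥0∞) / (orderAtZero φ : ℝ≥0∞)

end FiniteType

/-- `∂g/∂w` for a real function `g` of one complex variable. -/
def dw (g : ℂ → ℝ) (w : ℂ) : ℂ := del (fun x => (g x : ℂ)) w 1

/-- `∂²g/∂w∂(conj w)` for a real function `g` of one complex variable. -/
def dwdwBar (g : ℂ → ℝ) (w : ℂ) : ℂ := complexHessian g w 1 1

/-- The conditions imposed on each summand `g` of `h`. In `log_psh` the plurisubharmonicity of
`log g` is written as `∂²g/∂w∂(conj w) ≥ |∂g/∂w|² / g` (outside the origin, where `g > 0`). -/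
structure IsAdmissibleSummand (g : ℂ → ℝ) : Prop where
  smooth : ContDiff ℝ ∞ g
  nonneg : ∀ w, 0 ≤ g w
  psh : ∀ w, 0 ≤ (dwdwBar g w).re
  eq_zero_iff : ∀ w, g w = 0 ↔ w = 0
  grad_ne : ∀ w, w ≠ 0 → fderiv ℝ g w ≠ 0
  tendsto : Tendsto g (cocompact ℂ) atTop
  log_psh : ∀ w, w ≠ 0 → ‖dw g w‖ ^ 2 / g w ≤ (dwdwBar g w).re
  strictly_psh : StrictlyPlurisubharmonicOn g {w | w ≠ 0}
  finite_type : typeAtZero g < ⊤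
  exists_factor : ∃ (V : Set ℂ) (α : ℂ → ℂ), IsOpen V ∧ (0 : ℂ) ∈ V ∧ ContDiffOn ℝ ∞ α V ∧
    Tendsto α (𝓝 0) (𝓝 0) ∧ ∀ w ∈ V, dw g w = α w * dwdwBar g w

/-- Condition III: `h` is a sum of admissible functions of the single variables. -/
def ConditionIII {m : ℕ} (h : (Fin m → ℂ) → ℝ) : Prop :=
  ∃ g : Fin m → ℂ → ℝ, (∀ i, IsAdmissibleSummand (g i)) ∧ ∀ w, h w = ∑ i, g i (w i)

/-- The function `r(z, w) = ρ(z) + h(w)`. -/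
def hartogsFun {n m : ℕ} (ρ : (Fin n → ℂ) → ℝ) (h : (Fin m → ℂ) → ℝ) :
    (Fin n → ℂ) × (Fin m → ℂ) → ℝ :=
  fun p => ρ p.1 + h p.2

/-- The domain `{(z, w) : ρ(z) + h(w) < 0}`, where `z` ranges over the domain `U` of `ρ`. -/
def hartogsDomain {n m : ℕ} (U : Set (Fin n → ℂ)) (ρ : (Fin n → ℂ) → ℝ)
    (h : (Fin m → ℂ) → ℝ) : Set ((Fin n → ℂ) × (Fin m → ℂ)) :=
  {p | p.1 ∈ U ∧ hartogsFun ρ h p < 0}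

end Hartogs

end

/-!
Let `(z, w)` be a boundary point. Split the space as `W ⊕ span e`, where the `e i` are the
coordinate directions with `w i = 0`. The complex Hessian of `r` has no mixed terms with respect
to this splitting. On the tangent vectors in `W` its radical has dimension at most one: if `w = 0`
this is the rank hypothesis, and if `w ≠ 0` the form is even positive definite there, by the
strict plurisubharmonicity of `-(-ρ)^s`, the plurisubharmonicity of `log h_i` and Cauchy–Schwarz.
A basis of these tangent vectors which is orthogonal at the point extends to tangent fields, and
Gram–Schmidt along the non-null ones is smooth; at most one null field is left, and it is
orthogonal to all the others.

The `e i` may fail to be tangent, and `λ = ⟨∂∂̄r; e, ē⟩` may vanish at the point for `e = e i`. But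
`⟨∂r, e⟩ = αλ` with `α` smooth and vanishing at the point, so `λ` cancels in the quotients of
the Gram–Schmidt process along the tangential part of `e`, which therefore remain smooth.
-/

namespace Hartogs

open ComplexConjugate

local notation "∂[" f "]" => del (fun x => ((f x : ℝ) : ℂ))

section Calculus

variable {E F : Type*} [NormedAddCommGroup E] [NormedSpace ℂ E]
  [NormedAddCommGroup F] [NormedSpace ℂ F] {f g : E → ℝ} {z : E}

lemma fderiv_ofReal_apply (hf : DifferentiableAt ℝ f z) (t : E) :
    fderiv ℝ (fun x => (f x : ℂ)) z t = fderiv ℝ f z t := by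
  have h := Complex.ofRealCLM.hasFDerivAt.comp z hf.hasFDerivAt
  exact DFunLike.congr_fun h.fderiv t

lemma del_ofReal_apply (hf : DifferentiableAt ℝ f z) (t : E) :
    ∂[f] z t = (fderiv ℝ f z t - Complex.I * fderiv ℝ f z (Complex.I • t)) / 2 := by
  simp only [del, LinearMap.coe_mk, AddHom.coe_mk, fderiv_ofReal_apply hf]

lemma delBar_ofReal_apply (hf : DifferentiableAt ℝ f z) (t : E) :
    delBar (fun x => (f x : ℂ)) z t
      = (fderiv ℝ f z t + Complex.I * fderiv ℝ f z (Complex.I • t)) / 2 := by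
  simp only [delBar, fderiv_ofReal_apply hf]

lemma del_ofReal_eq_zero_iff (hf : DifferentiableAt ℝ f z) : ∂[f] z = 0 ↔ fderiv ℝ f z = 0 := by
  refine ⟨fun h => ContinuousLinearMap.ext fun t => ?_, fun h => LinearMap.ext fun t => ?_⟩
  · simpa [del_ofReal_apply hf] using congrArg Complex.re (LinearMap.congr_fun h t)
  · simp [del_ofReal_apply hf, h]

lemma mem_complexTangent {t : E} : t ∈ complexTangent f z ↔ ∂[f] z t = 0 :=
  Iff.rfl

lemma finrank_complexTangent [FiniteDimensional ℂ E] (h : ∂[f] z ≠ 0) :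
    Module.finrank ℂ (complexTangent f z) + 1 = Module.finrank ℂ E :=
  Module.Dual.finrank_ker_add_one_of_ne_zero h

lemma complexHessian_eq (hf : ContDiffAt ℝ 2 f z) (s t : E) :
    complexHessian f z s t
      = (fderiv ℝ (fderiv ℝ f) z s t
          + fderiv ℝ (fderiv ℝ f) z (Complex.I • s) (Complex.I • t)
          + Complex.I * (fderiv ℝ (fderiv ℝ f) z s (Complex.I • t)
            - fderiv ℝ (fderiv ℝ f) z (Complex.I • s) t)) / 4 := by
  have hdelBar : (fun y => delBar (fun x => (f x : ℂ)) y t) =ᶠ[𝓝 z] fun y =>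
      ((fderiv ℝ f y t : ℂ) + Complex.I * fderiv ℝ f y (Complex.I • t)) / 2 :=
    (hf.eventually (by simp)).mono fun y hy => delBar_ofReal_apply (hy.differentiableAt (by simp)) t
  have hf' : HasFDerivAt (fderiv ℝ f) (fderiv ℝ (fderiv ℝ f) z) z :=
    ((hf.fderiv_right (m := 1) (by norm_num)).differentiableAt (by simp)).hasFDerivAt
  have hv (v : E) : HasFDerivAt (fun y => (fderiv ℝ f y v : ℂ))
      (Complex.ofRealCLM.comp ((fderiv ℝ (fderiv ℝ f) z).flip v)) z :=
    Complex.ofRealCLM.hasFDerivAt.comp z (by simpa using hf'.clm_apply (hasFDerivAt_const v z))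
  have hderiv := ((hv t).fun_add ((hv (Complex.I • t)).const_mul Complex.I)).mul_const (2⁻¹ : ℂ)
  simp only [← div_eq_mul_inv] at hderiv
  simp only [complexHessian, del, LinearMap.coe_mk, AddHom.coe_mk]
  rw [hdelBar.fderiv_eq, hderiv.fderiv]
  simp only [smul_add, add_apply, smul_apply, ContinuousLinearMap.comp_apply,
    ContinuousLinearMap.flip_apply, Complex.ofRealCLM_apply, smul_eq_mul]
  linear_combination
    (-(fderiv ℝ (fderiv ℝ f) z (Complex.I • s) (Complex.I • t) : ℂ) / 4) * Complex.I_mul_I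

lemma complexHessian_zero_left (t : E) : complexHessian f z 0 t = 0 :=
  map_zero _

lemma complexHessian_add_left (x y t : E) :
    complexHessian f z (x + y) t = complexHessian f z x t + complexHessian f z y t :=
  map_add _ _ _

lemma complexHessian_sub_left (x y t : E) :
    complexHessian f z (x - y) t = complexHessian f z x t - complexHessian f z y t :=
  map_sub _ _ _

lemma complexHessian_smul_left (a : ℂ) (x t : E) :
    complexHessian f z (a • x) t = a * complexHessian f z x t :=
  map_smul _ _ _

lemma complexHessian_sum_left {ι : Type*} (S : Finset ι) (x : ι → E) (t : E) :
    complexHessian f z (∑ i ∈ S, x i) t = ∑ i ∈ S, complexHessian f z (x i) t :=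
  map_sum _ _ _

lemma conj_complexHessian (hf : ContDiffAt ℝ 2 f z) (s t : E) :
    conj (complexHessian f z s t) = complexHessian f z t s := by
  have hsymm : IsSymmSndFDerivAt ℝ f z := hf.isSymmSndFDerivAt (by simp)
  rw [complexHessian_eq hf, complexHessian_eq hf, hsymm.eq t s,
    hsymm.eq (Complex.I • t) (Complex.I • s), hsymm.eq t (Complex.I • s),
    hsymm.eq (Complex.I • t) s]
  simp only [map_div₀, map_add, map_sub, map_mul, map_ofNat, Complex.conj_ofReal, Complex.conj_I]
  ring

lemma complexHessian_sub_right (hf : ContDiffAt ℝ 2 f z) (t x y : E) :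
    complexHessian f z t (x - y) = complexHessian f z t x - complexHessian f z t y := by
  simp only [← conj_complexHessian hf _ t, complexHessian_sub_left, map_sub]

lemma complexHessian_smul_right (hf : ContDiffAt ℝ 2 f z) (a : ℂ) (t x : E) :
    complexHessian f z t (a • x) = conj a * complexHessian f z t x := by
  simp only [← conj_complexHessian hf _ t, complexHessian_smul_left, map_mul]

lemma complexHessian_sum_right {ι : Type*} (hf : ContDiffAt ℝ 2 f z) (S : Finset ι) (t : E)
    (x : ι → E) :
    complexHessian f z t (∑ i ∈ S, x i) = ∑ i ∈ S, complexHessian f z t (x i) := by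
  simp only [← conj_complexHessian hf _ t, complexHessian_sum_left, map_sum]

lemma del_add (hf : DifferentiableAt ℝ f z) (hg : DifferentiableAt ℝ g z) (t : E) :
    ∂[fun x => f x + g x] z t = ∂[f] z t + ∂[g] z t := by
  rw [del_ofReal_apply (hf.fun_add hg), del_ofReal_apply hf, del_ofReal_apply hg,
    fderiv_fun_add hf hg]
  simp only [add_apply, Complex.ofReal_add]
  ring

lemma del_sum {ι : Type*} (S : Finset ι) {f : ι → E → ℝ}
    (hf : ∀ i ∈ S, DifferentiableAt ℝ (f i) z) (t : E) :
    ∂[fun x => ∑ i ∈ S, f i x] z t = ∑ i ∈ S, ∂[f i] z t := by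
  rw [del_ofReal_apply (DifferentiableAt.fun_sum hf), fderiv_fun_sum hf,
    Finset.sum_congr rfl fun i hi => del_ofReal_apply (hf i hi) t]
  simp [Finset.mul_sum, ← Finset.sum_div, ← Finset.sum_sub_distrib]

lemma del_comp_clm {g : F → ℝ} {L : E →L[ℂ] F} (hg : DifferentiableAt ℝ g (L z)) (t : E) :
    ∂[fun x => g (L x)] z t = ∂[g] (L z) (L t) := by
  have h : HasFDerivAt (fun x => g (L x)) ((fderiv ℝ g (L z)).comp (L.restrictScalars ℝ)) z :=
    hg.hasFDerivAt.comp z (L.restrictScalars ℝ).hasFDerivAt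
  simp [del_ofReal_apply h.differentiableAt, del_ofReal_apply hg, h.fderiv]

lemma fderiv_fderiv_add (hf : ContDiffAt ℝ 2 f z) (hg : ContDiffAt ℝ 2 g z) :
    fderiv ℝ (fderiv ℝ fun x => f x + g x) z
      = fderiv ℝ (fderiv ℝ f) z + fderiv ℝ (fderiv ℝ g) z := by
  have hfderiv : fderiv ℝ (fun x => f x + g x) =ᶠ[𝓝 z] fun y => fderiv ℝ f y + fderiv ℝ g y := by
    filter_upwards [hf.eventually (by simp), hg.eventually (by simp)] with y hfy hgy
    exact fderiv_fun_add (hfy.differentiableAt (by simp)) (hgy.differentiableAt (by simp))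
  rw [hfderiv.fderiv_eq, fderiv_fun_add
    ((hf.fderiv_right (m := 1) (by norm_num)).differentiableAt (by simp))
    ((hg.fderiv_right (m := 1) (by norm_num)).differentiableAt (by simp))]

lemma complexHessian_add (hf : ContDiffAt ℝ 2 f z) (hg : ContDiffAt ℝ 2 g z) (s t : E) :
    complexHessian (fun x => f x + g x) z s t
      = complexHessian f z s t + complexHessian g z s t := by
  rw [complexHessian_eq (hf.add hg), complexHessian_eq hf, complexHessian_eq hg,
    fderiv_fderiv_add hf hg]
  push_cast [add_apply]
  ring

lemma complexHessian_sum {ι : Type*} (S : Finset ι) {f : ι → E → ℝ}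
    (hf : ∀ i ∈ S, ContDiffAt ℝ 2 (f i) z) (s t : E) :
    complexHessian (fun x => ∑ i ∈ S, f i x) z s t = ∑ i ∈ S, complexHessian (f i) z s t := by
  classical
  induction S using Finset.induction_on with
  | empty => simp [complexHessian_eq contDiffAt_const]
  | insert a S ha ih =>
    have hfS := fun i hi => hf i (Finset.mem_insert_of_mem hi)
    simp only [Finset.sum_insert ha]
    rw [complexHessian_add (hf a (Finset.mem_insert_self a S)) (ContDiffAt.sum hfS), ih hfS]

lemma fderiv_fderiv_comp_clm {E F : Type*} [NormedAddCommGroup E] [NormedSpace ℝ E]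
    [NormedAddCommGroup F] [NormedSpace ℝ F] {g : F → ℝ} {L : E →L[ℝ] F} {z : E}
    (hg : ContDiffAt ℝ 2 g (L z)) (s t : E) :
    fderiv ℝ (fderiv ℝ fun x => g (L x)) z s t = fderiv ℝ (fderiv ℝ g) (L z) (L s) (L t) := by
  have hfderiv : fderiv ℝ (fun x => g (L x)) =ᶠ[𝓝 z] fun y => (fderiv ℝ g (L y)).comp L := by
    filter_upwards [L.continuous.continuousAt.eventually (hg.eventually (by simp))] with y hy
    exact ((hy.differentiableAt (by simp)).hasFDerivAt.comp y L.hasFDerivAt).fderiv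
  have hg' : DifferentiableAt ℝ (fderiv ℝ g) (L z) :=
    (hg.fderiv_right (m := 1) (by norm_num)).differentiableAt (by simp)
  have hgL : HasFDerivAt (fun y => fderiv ℝ g (L y)) ((fderiv ℝ (fderiv ℝ g) (L z)).comp L) z :=
    hg'.hasFDerivAt.comp z L.hasFDerivAt
  rw [hfderiv.fderiv_eq, (hgL.clm_comp (hasFDerivAt_const L z)).fderiv]
  simp

lemma complexHessian_comp_clm {g : F → ℝ} {L : E →L[ℂ] F} (hg : ContDiffAt ℝ 2 g (L z)) (s t : E) :
    complexHessian (fun x => g (L x)) z s t = complexHessian g (L z) (L s) (L t) := by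
  have hcomp : ContDiffAt ℝ 2 (fun x => g (L x)) z :=
    hg.comp z (L.restrictScalars ℝ).contDiff.contDiffAt
  have hfderiv := fderiv_fderiv_comp_clm (L := L.restrictScalars ℝ) hg
  simp only [ContinuousLinearMap.coe_restrictScalars'] at hfderiv
  simp only [complexHessian_eq hcomp, complexHessian_eq hg, hfderiv, map_smul]

lemma fderiv_fderiv_comp_real {E : Type*} [NormedAddCommGroup E] [NormedSpace ℝ E] {f : E → ℝ}
    {z : E} (hf : ContDiffAt ℝ 2 f z) {φ φ' : ℝ → ℝ} {c : ℝ}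
    (hφ : ∀ᶠ x in 𝓝 (f z), HasDerivAt φ (φ' x) x) (hφ' : HasDerivAt φ' c (f z)) (s t : E) :
    fderiv ℝ (fderiv ℝ fun x => φ (f x)) z s t
      = φ' (f z) * fderiv ℝ (fderiv ℝ f) z s t + c * (fderiv ℝ f z s * fderiv ℝ f z t) := by
  have hfderiv : fderiv ℝ (fun x => φ (f x)) =ᶠ[𝓝 z] fun y => φ' (f y) • fderiv ℝ f y := by
    filter_upwards [hf.continuousAt.eventually hφ, hf.eventually (by simp)] with y hy hfy
    exact (hy.comp_hasFDerivAt y (hfy.differentiableAt (by simp)).hasFDerivAt).fderiv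
  have hf' : HasFDerivAt (fderiv ℝ f) (fderiv ℝ (fderiv ℝ f) z) z :=
    ((hf.fderiv_right (m := 1) (by norm_num)).differentiableAt (by simp)).hasFDerivAt
  have hφf : HasFDerivAt (fun y => φ' (f y)) (c • fderiv ℝ f z) z :=
    hφ'.comp_hasFDerivAt z (hf.differentiableAt (by simp)).hasFDerivAt
  rw [hfderiv.fderiv_eq, (hφf.fun_smul hf').fderiv]
  simp only [add_apply, smul_apply, ContinuousLinearMap.smulRight_apply, smul_eq_mul]
  ring

lemma complexHessian_comp_real (hf : ContDiffAt ℝ 2 f z) {φ φ' : ℝ → ℝ} {c : ℝ}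
    (hφ₂ : ContDiffAt ℝ 2 φ (f z)) (hφ : ∀ᶠ x in 𝓝 (f z), HasDerivAt φ (φ' x) x)
    (hφ' : HasDerivAt φ' c (f z)) (s t : E) :
    complexHessian (fun x => φ (f x)) z s t
      = φ' (f z) * complexHessian f z s t + c * (∂[f] z s * conj (∂[f] z t)) := by
  have hd := hf.differentiableAt (by simp)
  have hcomp : ContDiffAt ℝ 2 (fun x => φ (f x)) z := hφ₂.comp z hf
  simp only [complexHessian_eq hcomp, complexHessian_eq hf, del_ofReal_apply hd,
    fderiv_fderiv_comp_real hf hφ hφ', map_div₀, map_sub, map_mul, Complex.conj_ofReal,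
    Complex.conj_I, map_ofNat]
  push_cast
  linear_combination (c * (fderiv ℝ f z (Complex.I • s) * fderiv ℝ f z (Complex.I • t)) / 4 : ℂ)
    * Complex.I_mul_I

end Calculus

section SmoothNear

section Real

variable {E F G : Type*} [NormedAddCommGroup E] [NormedSpace ℝ E] [NormedAddCommGroup F]
  [NormedSpace ℝ F] [NormedAddCommGroup G] [NormedSpace ℝ G] {p : E}

/-- `f` is infinitely differentiable on a neighbourhood of `p`. This is stronger than
`ContDiffAt ℝ ∞ f p`, which only gives `C^k` regularity on a neighbourhood depending on `k`. -/
def SmoothNear (f : E → F) (p : E) : Prop := ∀ᶠ q in 𝓝 p, ContDiffAt ℝ ∞ f q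

lemma SmoothNear.of_contDiff {f : E → F} (hf : ContDiff ℝ ∞ f) : SmoothNear f p :=
  Eventually.of_forall fun _ => hf.contDiffAt

lemma SmoothNear.of_contDiffOn {f : E → F} {U : Set E} (hf : ContDiffOn ℝ ∞ f U) (hU : IsOpen U)
    (hp : p ∈ U) : SmoothNear f p := by
  filter_upwards [hU.mem_nhds hp] with q hq using hf.contDiffAt (hU.mem_nhds hq)

lemma smoothNear_const (c : F) : SmoothNear (fun _ => c) p :=
  .of_contDiff contDiff_const

lemma SmoothNear.continuousAt {f : E → F} (hf : SmoothNear f p) : ContinuousAt f p :=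
  hf.self_of_nhds.continuousAt

lemma SmoothNear.eventually_contDiffAt_two {f : E → F} (hf : SmoothNear f p) :
    ∀ᶠ q in 𝓝 p, ContDiffAt ℝ 2 f q :=
  hf.mono fun _ hq => hq.of_le (WithTop.coe_le_coe.mpr le_top)

lemma SmoothNear.congr {f g : E → F} (hf : SmoothNear f p) (hfg : g =ᶠ[𝓝 p] f) :
    SmoothNear g p := by
  filter_upwards [hf, hfg.eventuallyEq_nhds] with q hfq hq using hfq.congr_of_eventuallyEq hq

lemma SmoothNear.add {f g : E → F} (hf : SmoothNear f p) (hg : SmoothNear g p) :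
    SmoothNear (fun q => f q + g q) p := by
  filter_upwards [hf, hg] with q hfq hgq using hfq.add hgq

lemma SmoothNear.sub {f g : E → F} (hf : SmoothNear f p) (hg : SmoothNear g p) :
    SmoothNear (fun q => f q - g q) p := by
  filter_upwards [hf, hg] with q hfq hgq using hfq.sub hgq

lemma SmoothNear.neg {f : E → F} (hf : SmoothNear f p) : SmoothNear (fun q => -f q) p := by
  filter_upwards [hf] with q hfq using hfq.neg

lemma SmoothNear.sum {ι : Type*} {S : Finset ι} {f : ι → E → F} (hf : ∀ i ∈ S, SmoothNear (f i) p) :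
    SmoothNear (fun q => ∑ i ∈ S, f i q) p := by
  filter_upwards [(eventually_all_finset S).mpr hf] with q hq using ContDiffAt.sum hq

lemma SmoothNear.comp {g : F → G} {f : E → F} (hg : SmoothNear g (f p)) (hf : SmoothNear f p) :
    SmoothNear (fun q => g (f q)) p := by
  filter_upwards [hf, hf.continuousAt.eventually hg] with q hfq hgq using hgq.comp q hfq

lemma SmoothNear.fderiv {f : E → F} (hf : SmoothNear f p) : SmoothNear (fderiv ℝ f) p := by
  filter_upwards [hf] with q hfq using hfq.fderiv_right (by simp)

lemma SmoothNear.clm_apply {f : E → F →L[ℝ] G} {X : E → F} (hf : SmoothNear f p)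
    (hX : SmoothNear X p) :
    SmoothNear (fun q => f q (X q)) p := by
  filter_upwards [hf, hX] with q hfq hXq using hfq.clm_apply hXq

lemma SmoothNear.mul {f g : E → ℂ} (hf : SmoothNear f p) (hg : SmoothNear g p) :
    SmoothNear (fun q => f q * g q) p := by
  filter_upwards [hf, hg] with q hfq hgq using hfq.mul hgq

lemma SmoothNear.div {f g : E → ℂ} (hf : SmoothNear f p) (hg : SmoothNear g p) (hgp : g p ≠ 0) :
    SmoothNear (fun q => f q / g q) p := by
  filter_upwards [hf, hg, hg.continuousAt.eventually_ne hgp] with q hfq hgq hne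
  simp only [div_eq_mul_inv]
  exact hfq.mul (hgq.inv hne)

lemma SmoothNear.conj {f : E → ℂ} (hf : SmoothNear f p) : SmoothNear (fun q => conj (f q)) p := by
  filter_upwards [hf] with q hfq using Complex.conjCLE.contDiff.contDiffAt.comp q hfq

lemma SmoothNear.ofReal {f : E → ℝ} (hf : SmoothNear f p) : SmoothNear (fun q => (f q : ℂ)) p := by
  filter_upwards [hf] with q hfq using Complex.ofRealCLM.contDiff.contDiffAt.comp q hfq

end Real

variable {E F : Type*} [NormedAddCommGroup E] [NormedSpace ℂ E] [NormedAddCommGroup F]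
  [NormedSpace ℂ F] {p : E}

lemma SmoothNear.smul {a : E → ℂ} {X : E → F} (ha : SmoothNear a p) (hX : SmoothNear X p) :
    SmoothNear (fun q => a q • X q) p := by
  filter_upwards [ha, hX] with q haq hXq using haq.smul hXq

lemma SmoothNear.del {r : E → ℝ} {X : E → E} (hr : SmoothNear r p) (hX : SmoothNear X p) :
    SmoothNear (fun q => ∂[r] q (X q)) p := by
  have hIX := (smoothNear_const Complex.I).smul hX
  refine (((hr.fderiv.clm_apply hX).ofReal.sub ((smoothNear_const Complex.I).mul
    (hr.fderiv.clm_apply hIX).ofReal)).div (smoothNear_const 2) two_ne_zero).congr ?_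
  filter_upwards [hr] with q hq using del_ofReal_apply (hq.differentiableAt (by simp)) _

lemma SmoothNear.complexHessian {r : E → ℝ} {X Y : E → E} (hr : SmoothNear r p)
    (hX : SmoothNear X p) (hY : SmoothNear Y p) :
    SmoothNear (fun q => complexHessian r q (X q) (Y q)) p := by
  have hD {X Y : E → E} (hX : SmoothNear X p) (hY : SmoothNear Y p) :=
    ((hr.fderiv.fderiv.clm_apply hX).clm_apply hY).ofReal
  have hIX := (smoothNear_const Complex.I).smul hX
  have hIY := (smoothNear_const Complex.I).smul hY
  refine ((((hD hX hY).add (hD hIX hIY)).add ((smoothNear_const Complex.I).mul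
    ((hD hX hIY).sub (hD hIX hY)))).div (smoothNear_const 4) (by norm_num)).congr ?_
  filter_upwards [hr.eventually_contDiffAt_two] with q hq using complexHessian_eq hq _ _

/-- Near `p`, the function `u` is the product of `v` and a smooth function vanishing at `p`. -/
def IsVanishingMultipleNear (u v : E → ℂ) (p : E) : Prop :=
  ∃ c : E → ℂ, SmoothNear c p ∧ c p = 0 ∧ ∀ᶠ q in 𝓝 p, u q = c q * v q

lemma IsVanishingMultipleNear.congr {u v u' v' : E → ℂ} (h : IsVanishingMultipleNear u v p)
    (hu : u' =ᶠ[𝓝 p] u) (hv : v' =ᶠ[𝓝 p] v) : IsVanishingMultipleNear u' v' p := by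
  obtain ⟨c, hc, hc₀, hfac⟩ := h
  refine ⟨c, hc, hc₀, ?_⟩
  filter_upwards [hfac, hu, hv] with q hq hqu hqv
  rw [hqu, hqv, hq]

lemma IsVanishingMultipleNear.comp {u v : F → ℂ} {φ : E → F}
    (h : IsVanishingMultipleNear u v (φ p)) (hφ : SmoothNear φ p) :
    IsVanishingMultipleNear (fun q => u (φ q)) (fun q => v (φ q)) p := by
  obtain ⟨c, hc, hc₀, hfac⟩ := h
  exact ⟨fun q => c (φ q), hc.comp hφ, hc₀, hφ.continuousAt.eventually hfac⟩

lemma IsVanishingMultipleNear.apply_eq_zero {u v : E → ℂ} (h : IsVanishingMultipleNear u v p) :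
    u p = 0 := by
  obtain ⟨c, -, hcp, hc⟩ := h
  rw [hc.self_of_nhds, hcp, zero_mul]

end SmoothNear

section Radical

variable {E : Type*} [NormedAddCommGroup E] [NormedSpace ℂ E] {r : E → ℝ} {p : E}

/-- The radical of the restriction of the complex Hessian of `r` at `p` to the subspace `T`. -/
def hessianRadical (r : E → ℝ) (p : E) (T : Submodule ℂ E) : Submodule ℂ E where
  carrier := {x | x ∈ T ∧ ∀ t ∈ T, complexHessian r p x t = 0}
  add_mem' hx hy := ⟨T.add_mem hx.1 hy.1, fun t ht =>
    by rw [complexHessian_add_left, hx.2 t ht, hy.2 t ht, add_zero]⟩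
  zero_mem' := ⟨T.zero_mem, fun _ _ => complexHessian_zero_left _⟩
  smul_mem' c x hx := ⟨T.smul_mem c hx.1, fun t ht => by
    rw [complexHessian_smul_left, hx.2 t ht, mul_zero]⟩

lemma complexHessian_sum_smul {ι : Type*} [Fintype ι] (hr : ContDiffAt ℝ 2 r p) (b : ι → E)
    (x y : ι → ℂ) :
    complexHessian r p (∑ i, x i • b i) (∑ j, y j • b j)
      = star y ⬝ᵥ (Matrix.of fun j i => complexHessian r p (b i) (b j)).mulVec x := by
  rw [complexHessian_sum_right hr]
  refine Finset.sum_congr rfl fun j _ => ?_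
  rw [complexHessian_smul_right hr, complexHessian_sum_left]
  exact congrArg _ (Finset.sum_congr rfl fun i _ =>
    (complexHessian_smul_left _ _ _).trans (mul_comm _ _))

lemma exists_orthogonal_basis_complexHessian (hr : ContDiffAt ℝ 2 r p) (T : Submodule ℂ E)
    [FiniteDimensional ℂ T] :
    ∃ v : Module.Basis (Fin (Module.finrank ℂ T)) ℂ T,
      ∀ i j, i ≠ j → complexHessian r p (v i) (v j) = 0 := by
  let b := Module.finBasis ℂ T
  let A := Matrix.of fun j i => complexHessian r p (b i) (b j)
  have hA : A.IsHermitian := by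
    ext i j
    exact conj_complexHessian hr _ _
  let v := hA.eigenvectorBasis.toBasis.map ((WithLp.linearEquiv 2 ℂ _).trans b.equivFun.symm)
  have hv (k) : (v k : E) = ∑ i, hA.eigenvectorBasis k i • (b i : E) := by
    simp [v, Module.Basis.equivFun_symm_apply]
  refine ⟨v, fun k l hkl => ?_⟩
  have horth : inner ℂ (hA.eigenvectorBasis l) (hA.eigenvectorBasis k) = 0 :=
    hA.eigenvectorBasis.orthonormal.2 hkl.symm
  rw [EuclideanSpace.inner_eq_star_dotProduct, dotProduct_comm] at horth
  rw [hv, hv, complexHessian_sum_smul hr]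
  exact (congrArg _ (hA.mulVec_eigenvectorBasis k)).trans
    (by rw [dotProduct_smul, horth, smul_zero])

lemma mem_hessianRadical_of_orthogonal_basis {ι : Type*} [Finite ι] (hr : ContDiffAt ℝ 2 r p)
    {T : Submodule ℂ E} (v : Module.Basis ι ℂ T) {i : ι}
    (hv : ∀ j, complexHessian r p (v i) (v j) = 0) : (v i : E) ∈ hessianRadical r p T := by
  have := Fintype.ofFinite ι
  refine ⟨(v i).2, fun t ht => ?_⟩
  have hsum : t = ∑ j, v.repr ⟨t, ht⟩ j • (v j : E) := by
    simpa only [map_sum, map_smul, Submodule.subtype_apply]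
      using congrArg T.subtype (v.sum_repr ⟨t, ht⟩).symm
  rw [hsum, complexHessian_sum_right hr]
  exact Finset.sum_eq_zero fun j _ => by rw [complexHessian_smul_right hr, hv, mul_zero]

lemma subsingleton_null_of_finrank_hessianRadical_le_one {ι : Type*} [Finite ι]
    [FiniteDimensional ℂ E] (hr : ContDiffAt ℝ 2 r p) {T : Submodule ℂ E}
    (hT : Module.finrank ℂ (hessianRadical r p T) ≤ 1) (v : Module.Basis ι ℂ T)
    (hv : ∀ i j, i ≠ j → complexHessian r p (v i) (v j) = 0) :
    {i | complexHessian r p (v i) (v i) = 0}.Subsingleton := by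
  classical
  have := Fintype.ofFinite ι
  set N := {i | complexHessian r p (v i) (v i) = 0}
  have hmem (i : N) : (v i : E) ∈ hessianRadical r p T :=
    mem_hessianRadical_of_orthogonal_basis hr v fun j => by
      rcases eq_or_ne (i : ι) j with rfl | hij
      exacts [i.2, hv i j hij]
  have hindep : LinearIndependent ℂ fun i : N => (⟨v i, hmem i⟩ : hessianRadical r p T) :=
    .of_comp (hessianRadical r p T).subtype
      ((v.linearIndependent.map' T.subtype T.ker_subtype).comp (Subtype.val : N → ι)
      Subtype.val_injective)
  exact Set.subsingleton_coe _ |>.mp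
    (Fintype.card_le_one_iff_subsingleton.mp (hindep.fintype_card_le_finrank.trans hT))

lemma finrank_hessianRadical_add_leviRank [FiniteDimensional ℂ E] (hp : ∂[r] p ≠ 0) :
    Module.finrank ℂ (hessianRadical r p (complexTangent r p)) + leviRank r p + 1
      = Module.finrank ℂ E := by
  have hker : (LinearMap.ker (leviMap r p)).map (complexTangent r p).subtype
      = hessianRadical r p (complexTangent r p) := by
    ext x
    constructor
    · rintro ⟨y, hy, rfl⟩
      exact ⟨y.2, fun t ht => congrFun (LinearMap.mem_ker.mp hy) ⟨t, ht⟩⟩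
    · exact fun hx => ⟨⟨x, hx.1⟩, LinearMap.mem_ker.mpr (funext fun t => hx.2 t t.2), rfl⟩
  rw [← finrank_complexTangent hp, ← LinearMap.finrank_range_add_finrank_ker (leviMap r p), ← hker,
    Submodule.finrank_map_subtype_eq, leviRank, add_comm (Module.finrank ℂ (LinearMap.ker _))]

end Radical

section Frames

variable {E : Type*} [NormedAddCommGroup E] [NormedSpace ℂ E] {r : E → ℝ} {p : E}

/-- Near `p`, the field `X` is tangent to the level sets of `r`. -/
def TangentNear (r : E → ℝ) (p : E) (X : E → E) : Prop :=
  ∀ᶠ q in 𝓝 p, ∂[r] q (X q) = 0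

/-- Near `p`, the fields `X` and `Y` are orthogonal with respect to the complex Hessian of `r`. -/
def OrthogonalNear (r : E → ℝ) (p : E) (X Y : E → E) : Prop :=
  ∀ᶠ q in 𝓝 p, complexHessian r q (X q) (Y q) = 0

lemma TangentNear.sub_smul {X Y : E → E} (hY : TangentNear r p Y) (hX : TangentNear r p X)
    (c : E → ℂ) : TangentNear r p fun q => Y q - c q • X q := by
  filter_upwards [hY, hX] with q hYq hXq
  rw [map_sub, map_smul, hYq, hXq, smul_zero, sub_zero]

lemma OrthogonalNear.symm {X Y : E → E} (h : OrthogonalNear r p X Y) (hr : SmoothNear r p) :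
    OrthogonalNear r p Y X := by
  filter_upwards [h, hr.eventually_contDiffAt_two] with q hq hr₂
  rw [← conj_complexHessian hr₂, hq, map_zero]

lemma OrthogonalNear.sub_smul {X Y Z : E → E} (hY : OrthogonalNear r p Y Z)
    (hX : OrthogonalNear r p X Z) (c : E → ℂ) :
    OrthogonalNear r p (fun q => Y q - c q • X q) Z := by
  filter_upwards [hY, hX] with q hYq hXq
  rw [complexHessian_sub_left, complexHessian_smul_left, hYq, hXq, mul_zero, sub_zero]

lemma orthogonalNear_sub_smul {X Y : E → E} {c : E → ℂ}
    (h : ∀ᶠ q in 𝓝 p, complexHessian r q (Y q) (X q) = c q * complexHessian r q (X q) (X q)) :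
    OrthogonalNear r p (fun q => Y q - c q • X q) X := by
  filter_upwards [h] with q hq
  rw [complexHessian_sub_left, complexHessian_smul_left, hq, sub_self]

/-- Subtracting from `Z` its normal component `αλ`, where `λ = ⟨∂∂̄r; Z, Z̄⟩`, leaves a tangent
field `X` with `⟨∂∂̄r; X, X̄⟩ = λ D` and `D(p) = 1`. For `Y ⟂ Z` also `⟨∂∂̄r; Y, X̄⟩` is a multiple
of `λ`, so that projecting along `X` is smooth even where `λ` vanishes. -/
lemma exists_tangentNear_sub_smul (hr : SmoothNear r p) {Z ν : E → E} (hZ : SmoothNear Z p)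
    (hν : SmoothNear ν p) (hν₁ : ∀ᶠ q in 𝓝 p, ∂[r] q (ν q) = 1) (hνZ : OrthogonalNear r p ν Z)
    (hα : IsVanishingMultipleNear (fun q => ∂[r] q (Z q))
      (fun q => complexHessian r q (Z q) (Z q)) p) :
    ∃ β : E → ℂ, SmoothNear β p ∧ β p = 0 ∧ TangentNear r p (fun q => Z q - β q • ν q) ∧
      ∀ Y : E → E, SmoothNear Y p → OrthogonalNear r p Y Z →
        IsVanishingMultipleNear (fun q => complexHessian r q (Y q) (Z q - β q • ν q))
          (fun q => complexHessian r q (Z q - β q • ν q) (Z q - β q • ν q)) p := by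
  obtain ⟨α, hα, hαp, hZα⟩ := hα
  let l : E → ℂ := fun q => complexHessian r q (Z q) (Z q)
  let κ : E → ℂ := fun q => complexHessian r q (ν q) (ν q)
  let D : E → ℂ := fun q => 1 + α q * conj (α q) * (l q * κ q)
  have hl : SmoothNear l p := hr.complexHessian hZ hZ
  have hD : SmoothNear D p := (smoothNear_const 1).add
    ((hα.mul hα.conj).mul (hl.mul (hr.complexHessian hν hν)))
  have hDp : D p ≠ 0 := by simp [D, hαp]
  refine ⟨fun q => α q * l q, hα.mul hl, by simp [hαp], ?_, fun Y hY hYZ =>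
    ⟨fun q => -conj (α q) * complexHessian r q (Y q) (ν q) / D q,
      (hα.conj.neg.mul (hr.complexHessian hY hν)).div hD hDp, by simp [hαp], ?_⟩⟩
  · filter_upwards [hZα, hν₁] with q hq hνq
    rw [map_sub, map_smul, hq, hνq, smul_eq_mul, mul_one, sub_self]
  · filter_upwards [hYZ, hνZ, hνZ.symm hr, hr.eventually_contDiffAt_two,
      hD.continuousAt.eventually_ne hDp] with q hYq hνq hZq hr₂ hDq
    have hlq : conj (l q) = l q := conj_complexHessian hr₂ _ _
    have hYX : complexHessian r q (Y q) (Z q - (α q * l q) • ν q)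
        = -conj (α q) * l q * complexHessian r q (Y q) (ν q) := by
      rw [complexHessian_sub_right hr₂, complexHessian_smul_right hr₂, hYq, map_mul, hlq]
      ring
    have hXX : complexHessian r q (Z q - (α q * l q) • ν q) (Z q - (α q * l q) • ν q)
        = l q * D q := by
      rw [complexHessian_sub_right hr₂, complexHessian_smul_right hr₂, complexHessian_sub_left,
        complexHessian_sub_left, complexHessian_smul_left, complexHessian_smul_left, hνq, hZq,
        map_mul, hlq]
      ring
    rw [hYX, hXX]
    field_simp

variable {J : Type*} {O T : Set J} {Z : J → E → E} {ν : E → E}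

/-- Smooth fields `Z j` and a transversal field `ν` near `p`. The fields with index in `T` are
tangent, those with index in `O` are orthogonal to all the other fields. -/
structure IsPartialFrame (r : E → ℝ) (p : E) (O T : Set J) (Z : J → E → E) (ν : E → E) :
    Prop where
  smooth : ∀ j, SmoothNear (Z j) p
  smooth_normal : SmoothNear ν p
  normal : ∀ᶠ q in 𝓝 p, ∂[r] q (ν q) = 1
  tangent : ∀ j ∈ T, TangentNear r p (Z j)
  orthogonal : ∀ i ∈ O, ∀ j ≠ i, OrthogonalNear r p (Z j) (Z i)
  orthogonal_normal : ∀ i ∈ O, OrthogonalNear r p ν (Z i)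

namespace IsPartialFrame

lemma exists_exchange (h : IsPartialFrame r p O T Z ν) (hr : SmoothNear r p) {a : J} {X : E → E}
    (hX : SmoothNear X p) (hXp : X p = Z a p) (hXT : TangentNear r p X)
    (hXO : ∀ i ∈ O, i ≠ a → OrthogonalNear r p X (Z i))
    (hZX : ∀ j ≠ a, IsVanishingMultipleNear (fun q => complexHessian r q (Z j q) (X q))
      (fun q => complexHessian r q (X q) (X q)) p)
    (hνX : ∃ d : E → ℂ, SmoothNear d p ∧ ∀ᶠ q in 𝓝 p,
      complexHessian r q (ν q) (X q) = d q * complexHessian r q (X q) (X q)) :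
    ∃ Z' ν', IsPartialFrame r p (insert a O) (insert a T) Z' ν' ∧ (∀ j, Z' j p = Z j p) ∧
      Z' a = X ∧ ∀ j ∈ O, j ≠ a → Z' j = Z j := by
  have hZ' (j) : ∃ Y, SmoothNear Y p ∧ Y p = Z j p ∧ (j ∈ insert a T → TangentNear r p Y) ∧
      (j = a → Y = X) ∧ (j ∈ O → j ≠ a → Y = Z j) ∧ (j ≠ a → OrthogonalNear r p Y X) ∧
      ∀ i ∈ O, i ≠ a → j ≠ i → OrthogonalNear r p Y (Z i) := by
    rcases eq_or_ne j a with rfl | hja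
    · exact ⟨X, hX, hXp, fun _ => hXT, fun _ => rfl, fun _ hj => (hj rfl).elim,
        fun hj => (hj rfl).elim, fun i hi hij _ => hXO i hi hij⟩
    by_cases hjO : j ∈ O
    · exact ⟨Z j, h.smooth j, rfl, fun hj => h.tangent j (hj.resolve_left hja),
        fun hj => (hja hj).elim, fun _ _ => rfl, fun _ => (hXO j hjO hja).symm hr,
        fun i hi _ hji => h.orthogonal i hi j hji⟩
    · obtain ⟨c, hc, hcp, hcX⟩ := hZX j hja
      exact ⟨fun q => Z j q - c q • X q, (h.smooth j).sub (hc.smul hX), by simp [hcp],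
        fun hj => (h.tangent j (hj.resolve_left hja)).sub_smul hXT c, fun hj => (hja hj).elim,
        fun hj => (hjO hj).elim, fun _ => orthogonalNear_sub_smul hcX,
        fun i hi hia hji => (h.orthogonal i hi j hji).sub_smul (hXO i hi hia) c⟩
  choose Z' hZ's hZ'p hZ'T hZ'a hZ'O hZ'X hZ'Z using hZ'
  obtain ⟨d, hd, hνX⟩ := hνX
  refine ⟨Z', fun q => ν q - d q • X q, ⟨hZ's, h.smooth_normal.sub (hd.smul hX), ?_, hZ'T,
    fun i hi j hji => ?_, fun i hi => ?_⟩, hZ'p, hZ'a a rfl, hZ'O⟩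
  · filter_upwards [h.normal, hXT] with q hνq hXq
    rw [map_sub, map_smul, hνq, hXq, smul_zero, sub_zero]
  · rcases eq_or_ne i a with rfl | hia
    · exact hZ'a i rfl ▸ hZ'X j hji
    · have hiO := hi.resolve_left hia
      exact hZ'O i hiO hia ▸ hZ'Z j i hiO hia hji
  · rcases eq_or_ne i a with rfl | hia
    · rw [hZ'a i rfl]
      exact orthogonalNear_sub_smul hνX
    · have hiO := hi.resolve_left hia
      exact hZ'O i hiO hia ▸ (h.orthogonal_normal i hiO).sub_smul (hXO i hiO hia) d

lemma exists_insert_orthogonal (h : IsPartialFrame r p O T Z ν) (hr : SmoothNear r p) {a : J}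
    (ha : a ∈ T) (haa : complexHessian r p (Z a p) (Z a p) ≠ 0)
    (hja : ∀ j ≠ a, complexHessian r p (Z j p) (Z a p) = 0) :
    ∃ Z' ν', IsPartialFrame r p (insert a O) T Z' ν' ∧ (∀ j, Z' j p = Z j p) ∧
      ∀ j ∈ O, Z' j = Z j := by
  have hHa := hr.complexHessian (h.smooth a) (h.smooth a)
  have hne := hHa.continuousAt.eventually_ne haa
  have hdiv {Y : E → E} (hY : SmoothNear Y p) :=
    (hr.complexHessian hY (h.smooth a)).div hHa haa
  obtain ⟨Z', ν', h', hp, hZ'a, hZ'O⟩ := h.exists_exchange hr (h.smooth a) rfl (h.tangent a ha)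
    (fun i hi hia => h.orthogonal i hi a hia.symm)
    (fun j hj => ⟨_, hdiv (h.smooth j), by simp [hja j hj],
      hne.mono fun q hq => (div_mul_cancel₀ _ hq).symm⟩)
    ⟨_, hdiv h.smooth_normal, hne.mono fun q hq => (div_mul_cancel₀ _ hq).symm⟩
  rw [insert_eq_of_mem ha] at h'
  refine ⟨Z', ν', h', hp, fun j hj => ?_⟩
  rcases eq_or_ne j a with rfl | hja
  exacts [hZ'a, hZ'O j hj hja]

lemma exists_union_orthogonal (h : IsPartialFrame r p O T Z ν) (hr : SmoothNear r p)
    (horth : ∀ i j, i ≠ j → complexHessian r p (Z i p) (Z j p) = 0) (N : Finset J)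
    (hNT : ∀ a ∈ N, a ∈ T) (hN : ∀ a ∈ N, complexHessian r p (Z a p) (Z a p) ≠ 0) :
    ∃ Z' ν', IsPartialFrame r p (O ∪ N) T Z' ν' ∧ (∀ j, Z' j p = Z j p) ∧
      ∀ j ∈ O, Z' j = Z j := by
  classical
  induction N using Finset.induction_on with
  | empty => exact ⟨Z, ν, by simpa using h, fun _ => rfl, fun _ _ => rfl⟩
  | insert a N _ ih =>
    rw [Finset.forall_mem_insert] at hNT hN
    obtain ⟨Z₁, ν₁, h₁, hp₁, hO₁⟩ := ih hNT.2 hN.2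
    obtain ⟨Z₂, ν₂, h₂, hp₂, hO₂⟩ := h₁.exists_insert_orthogonal hr hNT.1
      (by simpa only [hp₁] using hN.1) fun j hj => by simpa only [hp₁] using horth j a hj
    rw [Finset.coe_insert, union_insert]
    exact ⟨Z₂, ν₂, h₂, fun j => (hp₂ j).trans (hp₁ j),
      fun j hj => (hO₂ j (.inl hj)).trans (hO₁ j hj)⟩

lemma exists_insert_tangent (h : IsPartialFrame r p O T Z ν) (hr : SmoothNear r p) {a : J}
    (ha : a ∈ O) (hα : IsVanishingMultipleNear (fun q => ∂[r] q (Z a q))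
      (fun q => complexHessian r q (Z a q) (Z a q)) p) :
    ∃ Z' ν', IsPartialFrame r p O (insert a T) Z' ν' ∧ (∀ j, Z' j p = Z j p) ∧
      ∀ j ∈ O, j ≠ a → Z' j = Z j := by
  have hνa := h.orthogonal_normal a ha
  obtain ⟨β, hβ, hβp, hXT, hYX⟩ :=
    exists_tangentNear_sub_smul hr (h.smooth a) h.smooth_normal h.normal hνa hα
  obtain ⟨d, hd, -, hνX⟩ := hYX ν h.smooth_normal hνa
  obtain ⟨Z', ν', h', hp, -, hZ'O⟩ := h.exists_exchange hr
    ((h.smooth a).sub (hβ.smul h.smooth_normal)) (by simp [hβp]) hXT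
    (fun i hi hia => (h.orthogonal i hi a hia.symm).sub_smul (h.orthogonal_normal i hi) β)
    (fun j hj => hYX _ (h.smooth j) (h.orthogonal a ha j hj)) ⟨d, hd, hνX⟩
  rw [insert_eq_of_mem ha] at h'
  exact ⟨Z', ν', h', hp, hZ'O⟩

lemma exists_union_tangent (h : IsPartialFrame r p O T Z ν) (hr : SmoothNear r p) (R : Finset J)
    (hRO : ∀ a ∈ R, a ∈ O) (hα : ∀ a ∈ R, IsVanishingMultipleNear (fun q => ∂[r] q (Z a q))
      (fun q => complexHessian r q (Z a q) (Z a q)) p) :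
    ∃ Z' ν', IsPartialFrame r p O (T ∪ R) Z' ν' ∧ (∀ j, Z' j p = Z j p) ∧
      ∀ j ∈ O, j ∉ R → Z' j = Z j := by
  classical
  induction R using Finset.induction_on with
  | empty => exact ⟨Z, ν, by simpa using h, fun _ => rfl, fun _ _ _ => rfl⟩
  | insert a R haR ih =>
    rw [Finset.forall_mem_insert] at hRO hα
    obtain ⟨Z₁, ν₁, h₁, hp₁, hO₁⟩ := ih hRO.2 hα.2
    obtain ⟨Z₂, ν₂, h₂, hp₂, hO₂⟩ := h₁.exists_insert_tangent hr hRO.1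
      (by simpa only [hO₁ a hRO.1 haR] using hα.1)
    rw [Finset.coe_insert, union_insert]
    refine ⟨Z₂, ν₂, h₂, fun j => (hp₂ j).trans (hp₁ j), fun j hj hjR => ?_⟩
    rw [Finset.mem_insert, not_or] at hjR
    exact (hO₂ j hj hjR.1).trans (hO₁ j hj hjR.2)

lemma exists_tangent_frame [Finite J] (h : IsPartialFrame r p O T Z ν) (hr : SmoothNear r p)
    (hOT : ∀ a ∉ O, a ∈ T) (horth : ∀ i j, i ≠ j → complexHessian r p (Z i p) (Z j p) = 0)
    (hnull : {a | a ∉ O ∧ complexHessian r p (Z a p) (Z a p) = 0}.Subsingleton)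
    (hα : ∀ a ∈ O, IsVanishingMultipleNear (fun q => ∂[r] q (Z a q))
      (fun q => complexHessian r q (Z a q) (Z a q)) p) :
    ∃ O' Z' ν', IsPartialFrame r p O' univ Z' ν' ∧ O'ᶜ.Subsingleton ∧ ∀ j, Z' j p = Z j p := by
  classical
  have := Fintype.ofFinite J
  let N := Finset.univ.filter fun a => a ∉ O ∧ complexHessian r p (Z a p) (Z a p) ≠ 0
  obtain ⟨Z₁, ν₁, h₁, hp₁, hO₁⟩ := h.exists_union_orthogonal hr horth N
    (fun a ha => hOT a (Finset.mem_filter.mp ha).2.1) fun a ha => (Finset.mem_filter.mp ha).2.2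
  have hα₁ (a) (ha : a ∈ Finset.univ.filter (· ∈ O)) :
      IsVanishingMultipleNear (fun q => ∂[r] q (Z₁ a q))
        (fun q => complexHessian r q (Z₁ a q) (Z₁ a q)) p := by
    simpa only [hO₁ a (Finset.mem_filter.mp ha).2] using hα a (Finset.mem_filter.mp ha).2
  obtain ⟨Z₂, ν₂, h₂, hp₂, -⟩ := h₁.exists_union_tangent hr (Finset.univ.filter (· ∈ O))
    (fun a ha => .inl (Finset.mem_filter.mp ha).2) hα₁
  have huniv : T ∪ ↑(Finset.univ.filter (· ∈ O)) = univ :=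
    eq_univ_of_forall fun a => (em (a ∈ O)).elim (fun ha => .inr (by simpa using ha))
      fun ha => .inl (hOT a ha)
  refine ⟨_, Z₂, ν₂, huniv ▸ h₂, hnull.anti fun a ha => ?_, fun j => (hp₂ j).trans (hp₁ j)⟩
  have ha' : a ∉ O ∧ (a ∉ O → complexHessian r p (Z a p) (Z a p) = 0) := by simpa [N] using ha
  exact ⟨ha'.1, ha'.2 ha'.1⟩

end IsPartialFrame

end Frames

section Diagonalization

lemma linearIndependent_sumElim_and_span_eq {K V : Type*} [Field K] [AddCommGroup V] [Module K V]
    {ι I : Type*} {W T : Submodule K V} (v : Module.Basis ι K (W ⊓ T : Submodule K V)) {e : I → V}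
    (he : LinearIndependent K e) (hWe : IsCompl W (Submodule.span K (range e)))
    (heT : ∀ i, e i ∈ T) :
    LinearIndependent K (Sum.elim (fun j => (v j : V)) e) ∧
      Submodule.span K (range (Sum.elim (fun j => (v j : V)) e)) = T := by
  have hv : LinearIndependent K fun j => (v j : V) :=
    v.linearIndependent.map' (W ⊓ T).subtype (Submodule.ker_subtype _)
  have hspan : Submodule.span K (range fun j => (v j : V)) = W ⊓ T := by
    have h := congrArg (Submodule.map (W ⊓ T).subtype) v.span_eq
    rwa [Submodule.map_span, ← range_comp, Submodule.map_subtype_top] at h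
  refine ⟨hv.sum_type he (by rw [hspan]; exact hWe.disjoint.mono_left inf_le_left), ?_⟩
  rw [Sum.elim_range, Submodule.span_union, hspan, inf_comm,
    inf_sup_assoc_of_le _ (Submodule.span_le.mpr (range_subset_iff.mpr heT)), hWe.sup_eq_top,
    inf_top_eq]

variable {E : Type*} [NormedAddCommGroup E] [NormedSpace ℂ E] {r : E → ℝ} {p : E} {J : Type*}

lemma eventually_pairwise_orthogonal [Finite J] {O : Set J} {Z : J → E → E} (hr : SmoothNear r p)
    (horth : ∀ i ∈ O, ∀ j ≠ i, OrthogonalNear r p (Z j) (Z i)) (hO : Oᶜ.Subsingleton) :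
    ∀ᶠ q in 𝓝 p, ∀ i j, i ≠ j → complexHessian r q (Z i q) (Z j q) = 0 := by
  refine eventually_all.mpr fun i => eventually_all.mpr fun j => eventually_imp_distrib_left.mpr
    fun hij => ?_
  by_cases hi : i ∈ O
  · exact (horth i hi j hij.symm).symm hr
  · by_cases hj : j ∈ O
    · exact horth j hj i hij
    · exact (hij (hO hi hj)).elim

lemma span_range_eq_complexTangent [FiniteDimensional ℂ E] [Fintype J] {q : E} {v : J → E}
    (hq : ∂[r] q ≠ 0) (hv : LinearIndependent ℂ v) (htan : ∀ j, ∂[r] q (v j) = 0)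
    (hcard : Fintype.card J + 1 = Module.finrank ℂ E) :
    Submodule.span ℂ (range v) = complexTangent r q := by
  refine Submodule.eq_of_le_of_finrank_eq (Submodule.span_le.mpr (range_subset_iff.mpr htan)) ?_
  have h := finrank_complexTangent hq
  rw [finrank_span_eq_card hv]
  omega

lemma IsPartialFrame.hasLocallyDiagonalizableLeviFormAt [FiniteDimensional ℂ E] [Finite J]
    {O : Set J} {Z : J → E → E} {ν : E → E} (h : IsPartialFrame r p O univ Z ν)
    (hr : SmoothNear r p) (hO : Oᶜ.Subsingleton) (hli : LinearIndependent ℂ fun j => Z j p)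
    (hspan : Submodule.span ℂ (range fun j => Z j p) = complexTangent r p) {D : Set E}
    (hD : ∀ᶠ q in 𝓝 p, q ∈ D ↔ r q < 0) : HasLocallyDiagonalizableLeviFormAt D r p := by
  have := Fintype.ofFinite J
  have hdel : ∀ᶠ q in 𝓝 p, ∂[r] q ≠ 0 := by
    filter_upwards [h.normal] with q hq h₀
    simp [h₀] at hq
  have htan : ∀ᶠ q in 𝓝 p, ∀ j, ∂[r] q (Z j q) = 0 :=
    eventually_all.mpr fun j => h.tangent j (mem_univ j)
  have hind : ∀ᶠ q in 𝓝 p, LinearIndependent ℂ fun j => Z j q :=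
    (continuousAt_pi.mpr fun j => (h.smooth j).continuousAt).eventually
      (isOpen_setOfPred_linearIndependent.mem_nhds hli)
  have hcard : Fintype.card J + 1 = Module.finrank ℂ E := by
    rw [← finrank_complexTangent hdel.self_of_nhds, ← hspan, finrank_span_eq_card hli]
  obtain ⟨V, hV, hVo, hpV⟩ := _root_.mem_nhds_iff.mp (hr.and (hD.and (hdel.and (htan.and
    ((eventually_pairwise_orthogonal hr h.orthogonal hO).and
      (hind.and (eventually_all.mpr h.smooth)))))))
  have hV' (q) (hq : q ∈ V) := hV hq
  simp only [mem_ofPred_eq] at hV'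
  choose hrV hDV hdelV htanV horthV hindV hsmV using hV'
  let e : Fin (Module.finrank ℂ E - 1) ≃ J :=
    (finCongr (by omega)).trans (Fintype.equivFin J).symm
  refine ⟨V, hVo, hpV, fun q hq => (hrV q hq).contDiffWithinAt, ?_, fun q hq h₀ => ?_,
    fun j => Z (e j), fun j q hq => (hsmV q hq (e j)).contDiffWithinAt,
    fun q hq => ⟨(hindV q hq).comp e e.injective, ?_⟩,
    fun q hq i j hij => horthV q hq _ _ (e.injective.ne hij)⟩
  · ext q
    exact ⟨fun hq => ⟨hq.2, (hDV q hq.2).mp hq.1⟩, fun hq => ⟨(hDV q hq.1).mpr hq.2, hq.1⟩⟩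
  · exact hdelV q hq
      ((del_ofReal_eq_zero_iff ((hrV q hq).differentiableAt (by simp))).mpr h₀)
  · rw [← span_range_eq_complexTangent (hdelV q hq) (hindV q hq) (htanV q hq) hcard]
    exact congrArg _ (e.surjective.range_comp fun j => Z j q)

lemma exists_isPartialFrame_of_decomposition {ι I : Type*} (hr : SmoothNear r p)
    {W : Submodule ℂ E} {e : I → E}
    (heW : ∀ i, ∀ᶠ q in 𝓝 p, ∀ t ∈ W, complexHessian r q (e i) t = 0)
    (hee : ∀ i j, i ≠ j → OrthogonalNear r p (fun _ => e i) fun _ => e j)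
    {n : E} (hnW : n ∈ W) (hn : ∂[r] p n ≠ 0) {v : ι → E} (hvW : ∀ j, v j ∈ W)
    (hv : ∀ j, ∂[r] p (v j) = 0) :
    ∃ (Z : ι ⊕ I → E → E) (ν : E → E), IsPartialFrame r p (range Sum.inr) (range Sum.inl) Z ν ∧
      (∀ j, Z j p = Sum.elim v e j) ∧ ∀ i, Z (Sum.inr i) = fun _ => e i := by
  have hdn := hr.del (smoothNear_const n)
  have hν : SmoothNear (fun q => (1 / ∂[r] q n) • n) p :=
    ((smoothNear_const 1).div hdn hn).smul (smoothNear_const n)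
  have hν₁ : ∀ᶠ q in 𝓝 p, ∂[r] q ((1 / ∂[r] q n) • n) = 1 := by
    filter_upwards [hdn.continuousAt.eventually_ne hn] with q hq
    rw [map_smul, smul_eq_mul, one_div_mul_cancel hq]
  have hWe {Y : E → E} (hY : ∀ q, Y q ∈ W) (i : I) : OrthogonalNear r p Y fun _ => e i :=
    .symm (X := fun _ => e i) ((heW i).mono fun q hq => hq _ (hY q)) hr
  have hνW (q) : (1 / ∂[r] q n) • n ∈ W := W.smul_mem _ hnW
  refine ⟨Sum.elim (fun j q => v j - ∂[r] q (v j) • (1 / ∂[r] q n) • n) fun i _ => e i,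
    fun q => (1 / ∂[r] q n) • n, ⟨?_, hν, hν₁, ?_, ?_, ?_⟩, ?_, fun _ => rfl⟩
  · rintro (j | i)
    exacts [(smoothNear_const (v j)).sub ((hr.del (smoothNear_const (v j))).smul hν),
      smoothNear_const (e i)]
  · rintro _ ⟨j, rfl⟩
    filter_upwards [hν₁] with q hq
    rw [Sum.elim_inl, map_sub, map_smul, hq, smul_eq_mul, mul_one, sub_self]
  · rintro _ ⟨i, rfl⟩ (j | k) hji
    · exact hWe (fun q => W.sub_mem (hvW j) (W.smul_mem _ (hνW q))) i
    · exact hee k i fun hki => hji (congrArg Sum.inr hki)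
  · rintro _ ⟨i, rfl⟩
    exact hWe hνW i
  · rintro (j | i)
    · simp [hv]
    · rfl

theorem hasLocallyDiagonalizableLeviFormAt_of_decomposition [FiniteDimensional ℂ E] {I : Type*}
    [Finite I] (hr : SmoothNear r p) {D : Set E} (hD : ∀ᶠ q in 𝓝 p, q ∈ D ↔ r q < 0)
    {W : Submodule ℂ E} {e : I → E} (he : LinearIndependent ℂ e)
    (hWe : IsCompl W (Submodule.span ℂ (range e)))
    (heW : ∀ i, ∀ᶠ q in 𝓝 p, ∀ t ∈ W, complexHessian r q (e i) t = 0)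
    (hee : ∀ i j, i ≠ j → OrthogonalNear r p (fun _ => e i) fun _ => e j)
    (hα : ∀ i, IsVanishingMultipleNear (fun q => ∂[r] q (e i))
      (fun q => complexHessian r q (e i) (e i)) p)
    {n : E} (hnW : n ∈ W) (hn : ∂[r] p n ≠ 0)
    (hrad : Module.finrank ℂ (hessianRadical r p (W ⊓ complexTangent r p)) ≤ 1) :
    HasLocallyDiagonalizableLeviFormAt D r p := by
  classical
  have hr₂ := hr.eventually_contDiffAt_two.self_of_nhds
  obtain ⟨v, hv⟩ := exists_orthogonal_basis_complexHessian hr₂ (W ⊓ complexTangent r p)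
  have hnull := subsingleton_null_of_finrank_hessianRadical_le_one hr₂ hrad v hv
  obtain ⟨Z, ν, hZ, hZp, hZe⟩ := exists_isPartialFrame_of_decomposition hr heW hee hnW hn
    (fun j => (v j).2.1) fun j => (v j).2.2
  have horth (i j) (hij : i ≠ j) : complexHessian r p (Z i p) (Z j p) = 0 := by
    rcases i with i | i
    · rcases j with j | j
      · rw [hZp, hZp]
        exact hv i j fun h => hij (congrArg _ h)
      · exact (hZ.orthogonal _ ⟨j, rfl⟩ _ hij).self_of_nhds
    · exact ((hZ.orthogonal _ ⟨i, rfl⟩ _ hij.symm).symm hr).self_of_nhds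
  obtain ⟨O, Z', ν', hZ', hO, hp⟩ := hZ.exists_tangent_frame hr (by simp) horth
    (by
      rintro (i | i) ⟨hiO, hi⟩ (j | j) ⟨hjO, hj⟩
      · rw [hZp] at hi hj
        exact congrArg _ (hnull hi hj)
      all_goals simp at hiO hjO)
    (by
      rintro _ ⟨i, rfl⟩
      simpa only [hZe] using hα i)
  obtain ⟨hli, hspan⟩ := linearIndependent_sumElim_and_span_eq v he hWe fun i =>
    mem_complexTangent.mpr (hα i).apply_eq_zero
  have hvalue : (fun j => Z' j p) = Sum.elim (fun j => (v j : E)) e :=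
    funext fun j => by rw [hp, hZp]
  rw [← hvalue] at hli hspan
  exact hZ'.hasLocallyDiagonalizableLeviFormAt hr hO hli hspan hD

end Diagonalization

section OneVariable

variable {g : ℂ → ℝ} {w : ℂ}

lemma del_eq_dw_mul (g : ℂ → ℝ) (w t : ℂ) : ∂[g] w t = dw g w * t := by
  conv_lhs => rw [← mul_one t, ← smul_eq_mul, map_smul, smul_eq_mul, mul_comm]
  rfl

lemma complexHessian_eq_dwdwBar_mul (hg : ContDiffAt ℝ 2 g w) (s t : ℂ) :
    complexHessian g w s t = dwdwBar g w * s * conj t := by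
  conv_lhs => rw [← mul_one s, ← mul_one t, ← smul_eq_mul, ← smul_eq_mul]
  rw [complexHessian_smul_left, complexHessian_smul_right hg, dwdwBar]
  ring

/-- The part of the conditions on a summand of `h` which makes the Levi form of `ρ + h` locally
diagonalizable. In `log_psh` the plurisubharmonicity of `log g` is written without division. -/
structure IsWeaklyAdmissibleSummand (g : ℂ → ℝ) : Prop where
  smooth : ContDiff ℝ ∞ g
  map_zero : g 0 = 0
  pos : ∀ w, w ≠ 0 → 0 < g w
  dw_ne_zero : ∀ w, w ≠ 0 → dw g w ≠ 0
  log_psh : ∀ w, w ≠ 0 → ‖dw g w‖ ^ 2 ≤ g w * (dwdwBar g w).re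
  factor : IsVanishingMultipleNear (dw g) (dwdwBar g) 0

namespace IsWeaklyAdmissibleSummand

lemma nonneg (hg : IsWeaklyAdmissibleSummand g) (w : ℂ) : 0 ≤ g w := by
  rcases eq_or_ne w 0 with rfl | hw
  exacts [hg.map_zero.ge, (hg.pos w hw).le]

lemma dwdwBar_re_pos (hg : IsWeaklyAdmissibleSummand g) (hw : w ≠ 0) : 0 < (dwdwBar g w).re :=
  pos_of_mul_pos_right
    ((pow_pos (norm_pos_iff.mpr (hg.dw_ne_zero w hw)) 2).trans_le (hg.log_psh w hw)) (hg.nonneg w)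

end IsWeaklyAdmissibleSummand

lemma IsAdmissibleSummand.isWeaklyAdmissibleSummand (hg : IsAdmissibleSummand g) :
    IsWeaklyAdmissibleSummand g := by
  have hpos (w : ℂ) (hw : w ≠ 0) : 0 < g w :=
    (hg.nonneg w).lt_of_ne' ((hg.eq_zero_iff w).not.mpr hw)
  obtain ⟨V, α, hV, h0, hα, hlim, hfac⟩ := hg.exists_factor
  refine ⟨hg.smooth, (hg.eq_zero_iff 0).mpr rfl, hpos, fun w hw h => ?_, fun w hw => ?_,
    α, .of_contDiffOn hα hV h0, ?_, ?_⟩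
  · refine hg.grad_ne w hw ((del_ofReal_eq_zero_iff
      (hg.smooth.contDiffAt.differentiableAt (by simp))).mp (LinearMap.ext fun t => ?_))
    rw [del_eq_dw_mul, h, zero_mul, LinearMap.zero_apply]
  · rw [← div_le_iff₀' (hpos w hw)]
    exact hg.log_psh w hw
  · exact tendsto_nhds_unique ((hα.contDiffAt (hV.mem_nhds h0)).continuousAt.tendsto) hlim
  · filter_upwards [hV.mem_nhds h0] with w hw using hfac w hw

end OneVariable

section HartogsSum

/-- The coordinate `w i` on the space of the pairs `(z, w)`. -/
noncomputable def sndCoord (E : Type*) [NormedAddCommGroup E] [NormedSpace ℂ E]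
    {ι : Type*} (i : ι) : E × (ι → ℂ) →L[ℂ] ℂ :=
  (ContinuousLinearMap.proj i).comp (ContinuousLinearMap.snd ℂ E (ι → ℂ))

variable {E ι : Type*} [NormedAddCommGroup E] [NormedSpace ℂ E] [Fintype ι] {ρ : E → ℝ}
  {g : ι → ℂ → ℝ} {p : E × (ι → ℂ)}

/-- The function `r(z, w) = ρ(z) + ∑ i, g_i(w_i)`. -/
def hartogsSum (ρ : E → ℝ) (g : ι → ℂ → ℝ) (p : E × (ι → ℂ)) : ℝ :=
  ρ p.1 + ∑ i, g i (p.2 i)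

lemma SmoothNear.hartogsSum (hρ : SmoothNear ρ p.1) (hg : ∀ i, ContDiff ℝ ∞ (g i)) :
    SmoothNear (hartogsSum ρ g) p :=
  (hρ.comp (.of_contDiff contDiff_fst)).add (.sum fun i _ => .of_contDiff
    ((hg i).comp ((sndCoord E i).restrictScalars ℝ).contDiff))

lemma del_hartogsSum (hρ : DifferentiableAt ℝ ρ p.1) (hg : ∀ i, Differentiable ℝ (g i))
    (t : E × (ι → ℂ)) :
    ∂[hartogsSum ρ g] p t = ∂[ρ] p.1 t.1 + ∑ i, dw (g i) (p.2 i) * t.2 i := by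
  have hfst : DifferentiableAt ℝ (fun q : E × (ι → ℂ) => ρ q.1) p := hρ.comp p differentiableAt_fst
  have hcoord (i : ι) : DifferentiableAt ℝ (fun q => g i (sndCoord E i q)) p :=
    ((hg i).comp ((sndCoord E i).restrictScalars ℝ).differentiable).differentiableAt
  have hsum := del_sum Finset.univ (fun i _ => hcoord i) t
  refine (del_add hfst (.fun_sum fun i _ => hcoord i) t).trans (congrArg₂ _
    (del_comp_clm (L := .fst ℂ E (ι → ℂ)) hρ t) (hsum.trans (Finset.sum_congr rfl fun i _ => ?_)))
  rw [del_comp_clm (hg i).differentiableAt, del_eq_dw_mul]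
  rfl

lemma complexHessian_hartogsSum (hρ : ContDiffAt ℝ 2 ρ p.1) (hg : ∀ i, ContDiff ℝ 2 (g i))
    (s t : E × (ι → ℂ)) :
    complexHessian (hartogsSum ρ g) p s t = complexHessian ρ p.1 s.1 t.1
      + ∑ i, dwdwBar (g i) (p.2 i) * s.2 i * conj (t.2 i) := by
  have hfst : ContDiffAt ℝ 2 (fun q : E × (ι → ℂ) => ρ q.1) p := hρ.comp p contDiffAt_fst
  have hcoord (i : ι) : ContDiffAt ℝ 2 (fun q => g i (sndCoord E i q)) p :=
    ((hg i).comp ((sndCoord E i).restrictScalars ℝ).contDiff).contDiffAt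
  have hsum := complexHessian_sum Finset.univ (fun i _ => hcoord i) s t
  refine (complexHessian_add hfst (.sum fun i _ => hcoord i) s t).trans (congrArg₂ _
    (complexHessian_comp_clm (L := .fst ℂ E (ι → ℂ)) hρ s t)
    (hsum.trans (Finset.sum_congr rfl fun i _ => ?_)))
  rw [complexHessian_comp_clm (hg i).contDiffAt,
    complexHessian_eq_dwdwBar_mul (hg i).contDiffAt]
  rfl

end HartogsSum

section Splitting

lemma isCompl_ker_span_of_dual {K V I : Type*} [Field K] [AddCommGroup V] [Module K V] [Finite I]
    [DecidableEq I] {π : V →ₗ[K] I → K} {e : I → V} (h : ∀ i, π (e i) = Pi.single i 1) :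
    LinearIndependent K e ∧ IsCompl (LinearMap.ker π) (Submodule.span K (range e)) := by
  have hπe : π ∘ e = fun i => Pi.single i 1 := funext h
  have hli : LinearIndependent K (π ∘ e) := hπe ▸ Pi.linearIndependent_single_one I K
  have hmap : (Submodule.span K (range e)).map π = ⊤ := by
    rw [Submodule.map_span, ← range_comp, hπe, ← (Pi.basisFun K I).span_eq]
    exact congrArg _ (congrArg _ (funext fun i => (Pi.basisFun_apply K I i).symm))
  refine ⟨hli.of_comp π, (Submodule.range_ker_disjoint hli).symm, codisjoint_iff.mpr ?_⟩
  rw [sup_comm, ← Submodule.comap_map_eq, hmap, Submodule.comap_top]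

/-- The coordinates `w i` with `a i = 0`, as a linear map on the space of the pairs `(z, w)`. -/
def vanishingCoords (E : Type*) [NormedAddCommGroup E] [NormedSpace ℂ E] {ι : Type*} (a : ι → ℂ) :
    E × (ι → ℂ) →ₗ[ℂ] ({i // a i = 0} → ℂ) :=
  (LinearMap.funLeft ℂ ℂ Subtype.val).comp (LinearMap.snd ℂ E (ι → ℂ))

lemma mem_ker_vanishingCoords {E : Type*} [NormedAddCommGroup E] [NormedSpace ℂ E] {ι : Type*}
    {a : ι → ℂ} {x : E × (ι → ℂ)} :
    x ∈ LinearMap.ker (vanishingCoords E a) ↔ ∀ i, a i = 0 → x.2 i = 0 :=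
  funext_iff.trans Subtype.forall

variable {E ι : Type*} [NormedAddCommGroup E] [NormedSpace ℂ E] [Fintype ι] {ρ : E → ℝ}
  {g : ι → ℂ → ℝ} {p : E × (ι → ℂ)}

lemma del_hartogsSum_single [DecidableEq ι] (hρ : DifferentiableAt ℝ ρ p.1)
    (hg : ∀ i, Differentiable ℝ (g i)) (i : ι) :
    ∂[hartogsSum ρ g] p (0, Pi.single i 1) = dw (g i) (p.2 i) := by
  simp [del_hartogsSum hρ hg, Pi.single_apply]

lemma complexHessian_hartogsSum_single_left [DecidableEq ι] (hρ : ContDiffAt ℝ 2 ρ p.1)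
    (hg : ∀ i, ContDiff ℝ 2 (g i)) (i : ι) (t : E × (ι → ℂ)) :
    complexHessian (hartogsSum ρ g) p (0, Pi.single i 1) t
      = dwdwBar (g i) (p.2 i) * conj (t.2 i) := by
  simp [complexHessian_hartogsSum hρ hg, complexHessian_zero_left, Pi.single_apply]

theorem hasLocallyDiagonalizableLeviFormAt_hartogsSum [FiniteDimensional ℂ E]
    (hρ : SmoothNear ρ p.1) (hg : ∀ i, ContDiff ℝ ∞ (g i))
    (hα : ∀ i, IsVanishingMultipleNear (dw (g i)) (dwdwBar (g i)) 0) {D : Set (E × (ι → ℂ))}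
    (hD : ∀ᶠ q in 𝓝 p, q ∈ D ↔ hartogsSum ρ g q < 0) {n : E × (ι → ℂ)}
    (hnW : n ∈ LinearMap.ker (vanishingCoords E p.2)) (hn : ∂[hartogsSum ρ g] p n ≠ 0)
    (hrad : Module.finrank ℂ (hessianRadical (hartogsSum ρ g) p
      (LinearMap.ker (vanishingCoords E p.2) ⊓ complexTangent (hartogsSum ρ g) p)) ≤ 1) :
    HasLocallyDiagonalizableLeviFormAt D (hartogsSum ρ g) p := by
  classical
  have hg₂ (i) : ContDiff ℝ 2 (g i) := (hg i).of_le (WithTop.coe_le_coe.mpr le_top)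
  have hρ₂ : ∀ᶠ q in 𝓝 p, ContDiffAt ℝ 2 ρ q.1 :=
    continuousAt_fst.eventually hρ.eventually_contDiffAt_two
  let e (i : {i // p.2 i = 0}) : E × (ι → ℂ) := (0, Pi.single i.1 1)
  have hdel (i) : ∀ᶠ q in 𝓝 p, ∂[hartogsSum ρ g] q (e i) = dw (g i) (q.2 i) := by
    filter_upwards [hρ₂] with q hq using del_hartogsSum_single (hq.differentiableAt (by simp))
      (fun j => (hg₂ j).differentiable (by simp)) i.1
  have hhess (i) : ∀ᶠ q in 𝓝 p, ∀ t,
      complexHessian (hartogsSum ρ g) q (e i) t = dwdwBar (g i) (q.2 i) * conj (t.2 i) := by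
    filter_upwards [hρ₂] with q hq using complexHessian_hartogsSum_single_left hq hg₂ i.1
  obtain ⟨he, hWe⟩ := isCompl_ker_span_of_dual (π := vanishingCoords E p.2) (e := e)
    fun i => funext fun j => by simp [e, vanishingCoords, Pi.single_apply, Subtype.ext_iff]
  refine hasLocallyDiagonalizableLeviFormAt_of_decomposition (hρ.hartogsSum hg) hD he hWe
    (fun i => ?_) (fun i j hij => ?_) (fun i => ?_) hnW hn hrad
  · filter_upwards [hhess i] with q hq t ht
    rw [hq, mem_ker_vanishingCoords.mp ht i i.2, map_zero, mul_zero]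
  · filter_upwards [hhess i] with q hq
    simp [hq, e, Subtype.coe_ne_coe.mpr hij]
  · have hαi : IsVanishingMultipleNear (dw (g i)) (dwdwBar (g i)) (sndCoord E i.1 p) := by
      simpa only [show sndCoord E i.1 p = 0 from i.2] using hα i
    refine (hαi.comp (.of_contDiff ((sndCoord E i.1).restrictScalars ℝ).contDiff)).congr (hdel i) ?_
    filter_upwards [hhess i] with q hq
    simp [hq, e, sndCoord]

end Splitting

section Positivity

variable {E : Type*} [NormedAddCommGroup E] [NormedSpace ℂ E] {f : E → ℝ} {z : E}

lemma complexHessian_neg_rpow_neg (hf : ContDiffAt ℝ 2 f z) (hz : f z < 0) (s : ℝ) (x t : E) :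
    complexHessian (fun y => -(-f y) ^ s) z x t
      = (s * (-f z) ^ (s - 1) : ℝ) * complexHessian f z x t
        + (s * (1 - s) * (-f z) ^ (s - 1 - 1) : ℝ) * (∂[f] z x * conj (∂[f] z t)) := by
  have hφ : ContDiffAt ℝ 2 (fun y : ℝ => -(-y) ^ s) (f z) :=
    (contDiffAt_id.neg.rpow_const_of_ne (by simpa using hz.ne)).neg
  refine complexHessian_comp_real (φ := fun y => -(-y) ^ s) (φ' := fun y => s * (-y) ^ (s - 1))
    hf hφ ((eventually_lt_nhds hz).mono fun y hy => ?_) ?_ x t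
  · exact ((hasDerivAt_neg y).rpow_const (.inl (by linarith))).neg.congr_deriv (by ring)
  · exact (((hasDerivAt_neg (f z)).rpow_const (.inl (by linarith))).const_mul s).congr_deriv
      (by ring)

lemma sq_norm_del_add_neg_mul_complexHessian_pos {s : ℝ} (hs : 0 < s) {D : Set E}
    (hpsh : StrictlyPlurisubharmonicOn (fun y => -(-f y) ^ s) D) (hz : z ∈ D)
    (hf : ContDiffAt ℝ 2 f z) (hneg : f z < 0) {t : E} (ht : t ≠ 0) :
    0 < ‖∂[f] z t‖ ^ 2 + -f z * (complexHessian f z t t).re := by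
  have hR : 0 < -f z := by linarith
  have hc : 0 < s * (-f z) ^ (s - 1) / -f z :=
    div_pos (mul_pos hs (Real.rpow_pos_of_pos hR _)) hR
  have hpos := hpsh z hz t ht
  rw [complexHessian_neg_rpow_neg hf hneg, Real.rpow_sub_one hR.ne' (s - 1), Complex.mul_conj,
    Complex.normSq_eq_norm_sq, Complex.add_re, Complex.re_ofReal_mul, Complex.re_ofReal_mul,
    Complex.ofReal_re] at hpos
  have hfactor : 0 < s * (-f z) ^ (s - 1) / -f z *
      (-f z * (complexHessian f z t t).re + (1 - s) * ‖∂[f] z t‖ ^ 2) := by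
    refine hpos.trans_eq ?_
    have hz₀ := hneg.ne
    field_simp
    ring
  have hsq := mul_nonneg hs.le (sq_nonneg ‖∂[f] z t‖)
  linarith [pos_of_mul_pos_right hfactor hc.le]

lemma sq_norm_sum_le_sum_mul_sum {ι : Type*} (S : Finset ι) {c : ι → ℂ} {a b : ι → ℝ}
    (ha : ∀ i ∈ S, 0 ≤ a i) (hb : ∀ i ∈ S, 0 ≤ b i) (hc : ∀ i ∈ S, ‖c i‖ ^ 2 ≤ a i * b i) :
    ‖∑ i ∈ S, c i‖ ^ 2 ≤ (∑ i ∈ S, a i) * ∑ i ∈ S, b i :=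
  (pow_le_pow_left₀ (norm_nonneg _) (norm_sum_le S c) 2).trans
    (Finset.sum_sq_le_sum_mul_sum_of_sq_le_mul S ha hb hc)

variable {ι : Type*} [Fintype ι] {ρ : E → ℝ} {g : ι → ℂ → ℝ} {p : E × (ι → ℂ)}

lemma complexHessian_hartogsSum_pos {s : ℝ} (hs : 0 < s) {D : Set E}
    (hpsh : StrictlyPlurisubharmonicOn (fun y => -(-ρ y) ^ s) D) (hz : p.1 ∈ D)
    (hρ : ContDiffAt ℝ 2 ρ p.1) (hg : ∀ i, IsWeaklyAdmissibleSummand (g i))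
    (hneg : ρ p.1 < 0) (hp : hartogsSum ρ g p = 0) {x : E × (ι → ℂ)}
    (hxW : x ∈ LinearMap.ker (vanishingCoords E p.2))
    (hxT : ∂[hartogsSum ρ g] p x = 0) (hx : x ≠ 0) :
    0 < (complexHessian (hartogsSum ρ g) p x x).re := by
  rw [mem_ker_vanishingCoords] at hxW
  have hg₂ (i) : ContDiff ℝ 2 (g i) := (hg i).smooth.of_le (WithTop.coe_le_coe.mpr le_top)
  rw [del_hartogsSum (hρ.differentiableAt (by simp))
    fun i => (hg₂ i).differentiable (by simp)] at hxT
  let b (i) : ℝ := (dwdwBar (g i) (p.2 i)).re * ‖x.2 i‖ ^ 2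
  have hhess : (complexHessian (hartogsSum ρ g) p x x).re
      = (complexHessian ρ p.1 x.1 x.1).re + ∑ i, b i := by
    rw [complexHessian_hartogsSum hρ hg₂, Complex.add_re, Complex.re_sum]
    simp only [mul_assoc, Complex.mul_conj, Complex.normSq_eq_norm_sq, Complex.re_mul_ofReal, b]
  have hbpos (i) (hi : x.2 i ≠ 0) : 0 < b i :=
    mul_pos ((hg i).dwdwBar_re_pos fun h => hi (hxW i h)) (pow_pos (norm_pos_iff.mpr hi) 2)
  have hb (i) : 0 ≤ b i := by
    by_cases hi : x.2 i = 0
    exacts [by simp [b, hi], (hbpos i hi).le]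
  rw [hhess]
  by_cases ht : x.1 = 0
  · obtain ⟨i, hi⟩ := Function.ne_iff.mp fun h : x.2 = 0 => hx (Prod.ext ht h)
    rw [ht, complexHessian_zero_left, Complex.zero_re, zero_add]
    exact Finset.sum_pos' (fun i _ => hb i) ⟨i, Finset.mem_univ i, hbpos i hi⟩
  · have hDF := sq_norm_del_add_neg_mul_complexHessian_pos hs hpsh hz hρ hneg ht
    have hCS : ‖∂[ρ] p.1 x.1‖ ^ 2 ≤ -ρ p.1 * ∑ i, b i := by
      rw [eq_neg_of_add_eq_zero_left hxT, norm_neg, ← eq_neg_of_add_eq_zero_right hp]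
      refine sq_norm_sum_le_sum_mul_sum _ (fun i _ => (hg i).nonneg _) (fun i _ => hb i)
        fun i _ => ?_
      by_cases hi : p.2 i = 0
      · simp [hxW i hi, b]
      · rw [norm_mul, mul_pow, ← mul_assoc]
        exact mul_le_mul_of_nonneg_right ((hg i).log_psh _ hi) (sq_nonneg _)
    refine pos_of_mul_pos_right (a := -ρ p.1) ?_ (by linarith)
    linarith

end Positivity

section Boundary

variable {E ι : Type*} [NormedAddCommGroup E] [NormedSpace ℂ E] [Fintype ι] {ρ : E → ℝ}
  {g : ι → ℂ → ℝ} {p : E × (ι → ℂ)}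

lemma finrank_hessianRadical_hartogsSum_le [FiniteDimensional ℂ E] (hρ : ContDiffAt ℝ 2 ρ p.1)
    (hg : ∀ i, ContDiff ℝ 2 (g i)) (hp : p.2 = 0) :
    Module.finrank ℂ (hessianRadical (hartogsSum ρ g) p
      (LinearMap.ker (vanishingCoords E p.2) ⊓ complexTangent (hartogsSum ρ g) p))
      ≤ Module.finrank ℂ (hessianRadical ρ p.1 (complexTangent ρ p.1)) := by
  have hW {x : E × (ι → ℂ)} : x ∈ LinearMap.ker (vanishingCoords E p.2) ↔ x.2 = 0 := by
    simp only [mem_ker_vanishingCoords, hp, Pi.zero_apply, forall_const, funext_iff]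
  have hT {x : E × (ι → ℂ)} (hx : x.2 = 0) :
      x ∈ complexTangent (hartogsSum ρ g) p ↔ x.1 ∈ complexTangent ρ p.1 := by
    rw [mem_complexTangent, mem_complexTangent, del_hartogsSum (hρ.differentiableAt (by simp))
      fun i => (hg i).differentiable (by simp)]
    simp [hx]
  have hfst (x) (hx : x ∈ hessianRadical (hartogsSum ρ g) p
      (LinearMap.ker (vanishingCoords E p.2) ⊓ complexTangent (hartogsSum ρ g) p)) :
      x.1 ∈ hessianRadical ρ p.1 (complexTangent ρ p.1) := by
    refine ⟨(hT (hW.mp hx.1.1)).mp hx.1.2, fun t ht => ?_⟩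
    have h := hx.2 (t, 0) ⟨hW.mpr rfl, (hT rfl).mpr ht⟩
    rw [complexHessian_hartogsSum hρ hg] at h
    simpa using h
  refine LinearMap.finrank_le_finrank_of_injective
    (f := (LinearMap.fst ℂ E (ι → ℂ)).restrict hfst) fun x y hxy => Subtype.ext (Prod.ext ?_ ?_)
  · exact congrArg Subtype.val hxy
  · rw [hW.mp x.2.1.1, hW.mp y.2.1.1]

theorem hasLocallyDiagonalizableLeviFormAt_hartogsSum_of_snd_eq_zero [FiniteDimensional ℂ E]
    (hρ : SmoothNear ρ p.1) (hdρ : ∂[ρ] p.1 ≠ 0)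
    (hrank : Module.finrank ℂ E ≤ leviRank ρ p.1 + 2) (hg : ∀ i, ContDiff ℝ ∞ (g i))
    (hα : ∀ i, IsVanishingMultipleNear (dw (g i)) (dwdwBar (g i)) 0) {D : Set (E × (ι → ℂ))}
    (hD : ∀ᶠ q in 𝓝 p, q ∈ D ↔ hartogsSum ρ g q < 0) (hp : p.2 = 0) :
    HasLocallyDiagonalizableLeviFormAt D (hartogsSum ρ g) p := by
  have hρ₂ := hρ.eventually_contDiffAt_two.self_of_nhds
  have hg₂ (i) : ContDiff ℝ 2 (g i) := (hg i).of_le (WithTop.coe_le_coe.mpr le_top)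
  obtain ⟨t, ht⟩ : ∃ t, ∂[ρ] p.1 t ≠ 0 := by
    by_contra! h
    exact hdρ (LinearMap.ext h)
  refine hasLocallyDiagonalizableLeviFormAt_hartogsSum hρ hg hα hD (n := (t, 0))
    (mem_ker_vanishingCoords.mpr fun _ _ => rfl) ?_ ?_
  · simpa [del_hartogsSum (hρ₂.differentiableAt (by simp))
      fun i => (hg₂ i).differentiable (by simp)] using ht
  · have hle := finrank_hessianRadical_hartogsSum_le hρ₂ hg₂ hp
    have hrad := finrank_hessianRadical_add_leviRank hdρ
    omega

theorem hasLocallyDiagonalizableLeviFormAt_hartogsSum_of_snd_ne_zero [FiniteDimensional ℂ E]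
    (hρ : SmoothNear ρ p.1) {s : ℝ} (hs : 0 < s) {Ω : Set E}
    (hpsh : StrictlyPlurisubharmonicOn (fun y => -(-ρ y) ^ s) Ω) (hz : p.1 ∈ Ω)
    (hneg : ρ p.1 < 0) (hg : ∀ i, IsWeaklyAdmissibleSummand (g i)) {D : Set (E × (ι → ℂ))}
    (hD : ∀ᶠ q in 𝓝 p, q ∈ D ↔ hartogsSum ρ g q < 0) (hp₀ : hartogsSum ρ g p = 0)
    (hp : p.2 ≠ 0) : HasLocallyDiagonalizableLeviFormAt D (hartogsSum ρ g) p := by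
  classical
  have hρ₂ := hρ.eventually_contDiffAt_two.self_of_nhds
  obtain ⟨j, hj⟩ := Function.ne_iff.mp hp
  refine hasLocallyDiagonalizableLeviFormAt_hartogsSum hρ (fun i => (hg i).smooth)
    (fun i => (hg i).factor) hD (n := (0, Pi.single j 1)) ?_ ?_ ?_
  · refine mem_ker_vanishingCoords.mpr fun i hi => ?_
    have hij : i ≠ j := fun h => hj (h ▸ hi)
    change (Pi.single j 1 : ι → ℂ) i = 0
    exact Pi.single_eq_of_ne hij _
  · rw [del_hartogsSum_single (hρ₂.differentiableAt (by simp))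
      fun i => (hg i).smooth.differentiable (by simp)]
    exact (hg j).dw_ne_zero _ hj
  · have hbot : hessianRadical (hartogsSum ρ g) p (LinearMap.ker (vanishingCoords E p.2) ⊓
        complexTangent (hartogsSum ρ g) p) = ⊥ := by
      refine (Submodule.eq_bot_iff _).mpr fun x hx => by_contra fun hx₀ => ?_
      have hpos := complexHessian_hartogsSum_pos hs hpsh hz hρ₂ hg hneg hp₀ hx.1.1 hx.1.2 hx₀
      rw [hx.2 x hx.1, Complex.zero_re] at hpos
      exact hpos.false
    rw [hbot, finrank_bot]
    exact zero_le_one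

lemma fst_mem_closure_of_mem_frontier {Ω U : Set E} (hρ : IsDefiningFunction Ω U ρ)
    (hg : ∀ i w, 0 ≤ g i w)
    (hp : p ∈ frontier {q : E × (ι → ℂ) | q.1 ∈ U ∧ hartogsSum ρ g q < 0}) : p.1 ∈ closure Ω := by
  refine map_mem_closure continuous_fst (frontier_subset_closure hp) fun q hq => ?_
  have hsum : 0 ≤ ∑ i, g i (q.2 i) := Finset.sum_nonneg fun i _ => hg i _
  have hneg : ρ q.1 + ∑ i, g i (q.2 i) < 0 := hq.2
  rw [hρ.eq_neg]
  exact ⟨hq.1, by linarith⟩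

lemma IsDefiningFunction.mem_frontier_of_eq_zero {Ω U : Set E} (hρ : IsDefiningFunction Ω U ρ)
    {z : E} (hz : z ∈ closure Ω) (hz₀ : ρ z = 0) : z ∈ frontier Ω := by
  refine ⟨hz, fun hmem_interior => ?_⟩
  have hmemΩ := interior_subset hmem_interior
  rw [hρ.eq_neg] at hmemΩ
  exact hmemΩ.2.ne hz₀

lemma eq_zero_of_mem_frontier {X : Type*} [TopologicalSpace X] {r : X → ℝ} {D : Set X} {p : X}
    (hp : p ∈ frontier D) (hD : ∀ᶠ q in 𝓝 p, q ∈ D ↔ r q < 0) (hr : ContinuousAt r p) :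
    r p = 0 := by
  rcases lt_trichotomy (r p) 0 with hlt | heq | hgt
  · refine absurd (mem_interior_iff_mem_nhds.mpr ?_) hp.2
    filter_upwards [hD, hr.eventually_lt_const hlt] with q hqD hq using hqD.mpr hq
  · exact heq
  · obtain ⟨q, ⟨hq, hqD⟩, hpos⟩ := (((mem_closure_iff_frequently.mp hp.1).and_eventually hD)
      |>.and_eventually (hr.eventually_const_lt hgt)).exists
    exact absurd (hqD.mp hq) hpos.not_gt

end Boundary

end Hartogs

open Hartogs in
theorem mainTheorem5_general {E ι : Type*} [NormedAddCommGroup E] [NormedSpace ℂ E]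
    [FiniteDimensional ℂ E] [Fintype ι] {Ω U : Set E} {ρ : E → ℝ} {s : ℝ} {g : ι → ℂ → ℝ}
    (hρ : IsDefiningFunction Ω U ρ) (hs : 0 < s)
    (hpsh : StrictlyPlurisubharmonicOn (fun z => -(-ρ z) ^ s) Ω)
    (hg : ∀ i, IsWeaklyAdmissibleSummand (g i))
    (hrank : ∀ z ∈ frontier Ω, Module.finrank ℂ E ≤ leviRank ρ z + 2) :
    ∀ p ∈ frontier {q : E × (ι → ℂ) | q.1 ∈ U ∧ hartogsSum ρ g q < 0},
      HasLocallyDiagonalizableLeviFormAt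
        {q : E × (ι → ℂ) | q.1 ∈ U ∧ hartogsSum ρ g q < 0} (hartogsSum ρ g) p := by
  intro p hp
  have hz := fst_mem_closure_of_mem_frontier hρ (fun i => (hg i).nonneg) hp
  have hU : U ∈ 𝓝 p.1 := hρ.isOpen.mem_nhds (hρ.closure_subset hz)
  have hsm : SmoothNear ρ p.1 := .of_contDiffOn hρ.smooth hρ.isOpen (hρ.closure_subset hz)
  have hD : ∀ᶠ q in 𝓝 p, q ∈ {q : E × (ι → ℂ) | q.1 ∈ U ∧ hartogsSum ρ g q < 0} ↔
      hartogsSum ρ g q < 0 := by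
    filter_upwards [continuousAt_fst.eventually hU] with q hq using and_iff_right hq
  have hp₀ : ρ p.1 + ∑ i, g i (p.2 i) = 0 :=
    eq_zero_of_mem_frontier (r := hartogsSum ρ g) hp hD
      (hsm.hartogsSum fun i => (hg i).smooth).continuousAt
  by_cases hw : p.2 = 0
  · have hρ₀ : ρ p.1 = 0 := by simpa [hw, (hg _).map_zero] using hp₀
    have hfr := hρ.mem_frontier_of_eq_zero hz hρ₀
    have hdiff := hsm.eventually_contDiffAt_two.self_of_nhds.differentiableAt (by simp)
    exact hasLocallyDiagonalizableLeviFormAt_hartogsSum_of_snd_eq_zero hsm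
      ((del_ofReal_eq_zero_iff hdiff).not.mpr (hρ.grad_ne _ hfr)) (hrank _ hfr)
      (fun i => (hg i).smooth) (fun i => (hg i).factor) hD hw
  · obtain ⟨j, hj⟩ := Function.ne_iff.mp hw
    have hsum : 0 < ∑ i, g i (p.2 i) := Finset.sum_pos' (fun i _ => (hg i).nonneg _)
      ⟨j, Finset.mem_univ j, (hg j).pos _ hj⟩
    have hneg : ρ p.1 < 0 := by linarith
    have hΩ : p.1 ∈ Ω := hρ.eq_neg ▸ ⟨hρ.closure_subset hz, hneg⟩
    exact hasLocallyDiagonalizableLeviFormAt_hartogsSum_of_snd_ne_zero hsm hs hpsh hΩ hneg hg hD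
      hp₀ hw

theorem mainTheorem5 (n m : ℕ) (Ω U : Set (Fin n → ℂ)) (ρ : (Fin n → ℂ) → ℝ) (s : ℝ)
    (h : (Fin m → ℂ) → ℝ)
    (hΩ : Hartogs.IsSmoothBoundedPseudoconvex Ω U ρ)
    (hρ : Hartogs.IsDiederichFornaess Ω ρ s)
    (hh : Hartogs.ConditionIII h)
    (hrank : ∀ z ∈ frontier Ω, n ≤ Hartogs.leviRank ρ z + 2) :
    ∀ p ∈ frontier (Hartogs.hartogsDomain U ρ h),
      Hartogs.HasLocallyDiagonalizableLeviFormAt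
        (Hartogs.hartogsDomain U ρ h) (Hartogs.hartogsFun ρ h) p := by
  obtain ⟨g, hg, hgh⟩ := hh
  obtain rfl : h = fun w => ∑ i, g i (w i) := funext hgh
  exact mainTheorem5_general hΩ.defining hρ.1 hρ.2.2 (fun i => (hg i).isWeaklyAdmissibleSummand)
    (by simpa only [Module.finrank_fin_fun] using hrank)
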